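/- Let $R$ be a commutative Noetherian ring with identity, let $\mathfrak{a}$ be an ideal of $R$ contained in the Jacobson radical of $R$, and let $M$ be a nonzero finitely generated $R$-module. For an $R$-module $N$ and $i\ge 0$ let $\operatorname{H}^i_{\mathfrak a}(N)=\varinjlim_n \operatorname{Ext}^i_R(R/\mathfrak a^n,N)$ be the $i$-th local cohomology module, and let $\operatorname{cd}(\mathfrak a,N)$ be the largest integer $i$ with $\operatorname{H}^i_{\mathfrak a}(N)\neq 0$ (with $\operatorname{cd}(\mathfrak a,N)=-\infty$ if there is no such $i$). For a finitely generated $R$-module $N$, let $\operatorname{grade}(\mathfrak a,N)$ be the supremum of the lengths of the $N$-regular sequences contained in $\mathfrak a$ if $N\neq \mathfrak aN$, and $\infty$ if $N=\mathfrak aN$. A finitely generated $R$-module $N$ is called $\mathfrak a$-relative Cohen–Macaulay if either $N=\mathfrak aN$, or $N\neq\mathfrak aN$ and $\operatorname{grade}(\mathfrak a,N)=\operatorname{cd}(\mathfrak a,N)$. Then the following are equivalent: (i) $M$ is $\mathfrak a$-relative Cohen–Macaulay; (ii) $\operatorname{cd}(\mathfrak a,R/\mathfrak p)=\operatorname{grade}(\mathfrak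 a,M)$ for all $\mathfrak p\in\operatorname{Ass}_R M$. -/

import Mathlib

universe u

/-- The cohomological dimension `cd(a, M)`: the largest `i` for which the `i`-th local cohomology
module `H^i_a(M) = colim_n Ext^i(R / a ^ n, M)` is nonzero, as a supremum in `WithBot ℕ∞`
(it is `⊥` if all the local cohomology modules vanish). -/
noncomputable def cohomologicalDim {R : Type u} [CommRing R] (a : Ideal R)
    (M : Type u) [AddCommGroup M] [Module R M] : WithBot ℕ∞ :=
  ⨆ (i : ℕ) (_ : Nontrivial ((localCohomology a i).obj (ModuleCat.of R M))),
    ((i : ℕ∞) : WithBot ℕ∞)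

open Classical in
/-- The grade of an ideal `a` on a finitely generated module `M` over a Noetherian ring: the
supremum of the lengths of the `M`-regular sequences contained in `a` if `M ≠ a M`, and `∞`
if `M = a M`. -/
noncomputable def moduleGrade {R : Type u} [CommRing R] (a : Ideal R)
    (M : Type u) [AddCommGroup M] [Module R M] : ℕ∞ :=
  if a • (⊤ : Submodule R M) = ⊤ then ⊤
  else ⨆ (rs : List R) (_ : (∀ r ∈ rs, r ∈ a) ∧ RingTheory.Sequence.IsRegular M rs),
    (rs.length : ℕ∞)

/-- A finitely generated module `M` is `a`-relative Cohen-Macaulay if either `M = a M`, or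
`M ≠ a M` and `grade(a, M) = cd(a, M)`. -/
def IsRelativeCohenMacaulay {R : Type u} [CommRing R] (a : Ideal R)
    (M : Type u) [AddCommGroup M] [Module R M] : Prop :=
  a • (⊤ : Submodule R M) = ⊤ ∨
    (a • (⊤ : Submodule R M) ≠ ⊤ ∧ (moduleGrade a M : WithBot ℕ∞) = cohomologicalDim a M)

/-! For `p` in `Ass M` everything follows from the chain grade(a,M) ≤ cd(a,R/p) ≤ cd(a,M) ≤ sup
cd(a,R/q), with q running over `Ass M`.

The first inequality is the heart (`linearMap_eq_zero_of_lcVanish`): if the local cohomology of L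
vanishes in degrees ≥ n, and N is finite with Ext^j(R/a^k, N) = 0 for all k and all j < n, then
Hom(L, N) = 0. An N-regular sequence of length n in a gives the Ext condition. If cd(a,R/p) were
smaller than the length of an M-regular sequence in a, the embedding R/p → M would therefore be
zero. To prove the vanishing, resolve L by a Čech-type complex. Its positive terms have no Ext into
modules killed by a power of a. Its cohomology is a-torsion, so it has no Ext^j into N for j < n,
and it is zero in positive degrees ≥ n. Dimension shifting along the complex kills every composite L
→ N → N/a^kN, and Krull's intersection theorem, which uses that a lies in the Jacobson radical,
gives the rest.

The other inequalities depend only on supports. Prime filtrations reduce vanishing for M to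
vanishing for R/q with q in Supp M (`lcVanish_of_forall_mem_support`). Conversely, a nonzero map M →
R/q transfers high-degree vanishing from M to R/q (`lcVanish_of_mem_support`). -/

section

open CategoryTheory Limits Opposite

/-! ### Cocycles on projective resolutions, for both versions of Ext. -/

namespace CategoryTheory.ProjectiveResolution

variable {C : Type*} [Category* C] [Abelian C]

/-- A cocycle of degree `0` which is zero in `Ext` is zero. -/
lemma extMk_zero_eq_zero_iff [HasExt.{u} C] {X Y : C} (P : ProjectiveResolution X)
    (f : P.complex.X 0 ⟶ Y) (m : ℕ) (hm : 0 + 1 = m) (hf : P.complex.d m 0 ≫ f = 0) :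
    P.extMk f m hm hf = 0 ↔ f = 0 := by
  simp only [← P.extEquivCohomologyClass.apply_eq_iff_eq,
    extEquivCohomologyClass_extMk, extEquivCohomologyClass_zero,
    CochainComplex.HomComplex.CohomologyClass.mk_eq_zero_iff]
  rw [CochainComplex.HomComplex.Cocycle.toSingleMk_mem_coboundaries_iff _ _ _ _ _ 1 (by simp)]
  -- The resolution sits in nonpositive cohomological degrees, so a coboundary in degree 0 factors
  -- through a zero object.
  have hz : IsZero (P.cochainComplex.X 1) :=
    CochainComplex.isZero_of_isStrictlyLE P.cochainComplex 0 1 (by norm_num)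
  constructor
  · rintro ⟨g, hg⟩
    rw [hz.eq_of_src g 0, comp_zero] at hg
    exact (cancel_epi (P.cochainComplexXIso (-(0 : ℕ)) 0 rfl).hom).1 (by rw [← hg, comp_zero])
  · rintro rfl
    exact ⟨0, by simp⟩

/-- Phrased with `next` so as to match `UnopRepresents.eq_zero_iff`; in degree 0, where `next 0 =
0`, the differential is zero and the condition reads `f = 0`. -/
lemma extMk_eq_zero_iff_exists_next [HasExt.{u} C] {X Y : C} (P : ProjectiveResolution X) {n : ℕ}
    (f : P.complex.X n ⟶ Y) (m : ℕ) (hm : n + 1 = m) (hf : P.complex.d m n ≫ f = 0) :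
    P.extMk f m hm hf = 0 ↔
      ∃ g : P.complex.X ((ComplexShape.down ℕ).next n) ⟶ Y, P.complex.d n _ ≫ g = f := by
  rcases n with _ | n
  · rw [extMk_zero_eq_zero_iff]
    constructor
    · rintro rfl
      exact ⟨0, by simp⟩
    · rintro ⟨g, hg⟩
      rw [← hg, P.complex.shape _ _ (by simp), zero_comp]
  · rw [P.extMk_eq_zero_iff f m hm hf n rfl]
    have : (ComplexShape.down ℕ).next (n + 1) = n := ChainComplex.next_nat_succ n
    rw [this]

end CategoryTheory.ProjectiveResolution

namespace HomologicalComplex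

variable {R : Type*} [Ring R] {ι : Type*} {c : ComplexShape ι}

section

variable (K : HomologicalComplex (ModuleCat.{u} R)ᵒᵖ c) (n : ι)

/-- A class in the opposite of the homology is represented by a cocycle. -/
def UnopRepresents (e : (K.homology n).unop) (f : (K.X n).unop) : Prop :=
  ∃ z : (K.opcycles n).unop, (K.homologyι n).unop.hom z = e ∧ (K.pOpcycles n).unop.hom z = f

lemma unopRepresents_exists_cocycle (e : (K.homology n).unop) :
    ∃ f, (K.d (c.prev n) n).unop.hom f = 0 ∧ K.UnopRepresents n e f := by
  have hs : Function.Surjective (K.homologyι n).unop.hom :=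
    (ModuleCat.epi_iff_surjective _).1 inferInstance
  obtain ⟨z, rfl⟩ := hs e
  refine ⟨_, ?_, z, rfl, rfl⟩
  have := congr($(congrArg Quiver.Hom.unop (K.d_pOpcycles (c.prev n) n)).hom z)
  exact this

lemma unopRepresents_exists_class (f : (K.X n).unop)
    (hf : (K.d (c.prev n) n).unop.hom f = 0) : ∃ e, K.UnopRepresents n e f := by
  have h := (ShortComplex.exact_of_g_is_cokernel
    (ShortComplex.mk (K.d (c.prev n) n) (K.pOpcycles n) (K.d_pOpcycles _ _))
    (K.opcyclesIsCokernel _ n rfl)).unop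
  rw [ShortComplex.moduleCat_exact_iff] at h
  obtain ⟨z, hz⟩ := h f hf
  exact ⟨_, z, rfl, hz⟩

variable {K n}

lemma UnopRepresents.eq_zero_iff {e : (K.homology n).unop} {f : (K.X n).unop}
    (h : K.UnopRepresents n e f) :
    e = 0 ↔ ∃ g, (K.d n (c.next n)).unop.hom g = f := by
  obtain ⟨z, rfl, rfl⟩ := h
  have hi : Function.Injective (K.pOpcycles n).unop.hom :=
    (ModuleCat.mono_iff_injective _).1 inferInstance
  have hd (g) : (K.d n (c.next n)).unop.hom g =
      (K.pOpcycles n).unop.hom ((K.fromOpcycles n (c.next n)).unop.hom g) := by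
    exact congr($(congrArg Quiver.Hom.unop (K.p_fromOpcycles n (c.next n)).symm).hom g)
  constructor
  · intro h0
    have h := (ShortComplex.exact_of_f_is_kernel
      (ShortComplex.mk (K.homologyι n) (K.fromOpcycles n (c.next n))
        (K.homologyι_comp_fromOpcycles _ _))
      (K.homologyIsKernel n _ rfl)).unop
    rw [ShortComplex.moduleCat_exact_iff] at h
    obtain ⟨g, hg⟩ := h z h0
    exact ⟨g, (hd g).trans (congrArg _ hg)⟩
  · rintro ⟨g, hg⟩
    rw [hd] at hg
    rw [← hi hg]
    exact congr($(congrArg Quiver.Hom.unop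
      (K.homologyι_comp_fromOpcycles n (c.next n))).hom g)

lemma UnopRepresents.map {L : HomologicalComplex (ModuleCat.{u} R)ᵒᵖ c} (φ : L ⟶ K)
    {e : (K.homology n).unop} {f : (K.X n).unop} (h : K.UnopRepresents n e f) :
    L.UnopRepresents n ((homologyMap φ n).unop.hom e) ((φ.f n).unop.hom f) := by
  obtain ⟨z, rfl, rfl⟩ := h
  refine ⟨(opcyclesMap φ n).unop.hom z, ?_, ?_⟩
  · exact congr($(congrArg Quiver.Hom.unop (homologyι_naturality φ n).symm).hom z)
  · exact congr($(congrArg Quiver.Hom.unop (p_opcyclesMap φ n)).hom z)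

end

end HomologicalComplex

namespace CategoryTheory.ProjectiveResolution

variable {C : Type*} [Category.{u} C] [Abelian C] {R : Type*} [Ring R] [Linear R C]
  [EnoughProjectives C]

variable (R) in
/-- The complex in the opposite category of modules of the morphisms from a projective resolution
to a given object. -/
abbrev homComplex {X : C} (P : ProjectiveResolution X) (Y : C) :
    ChainComplex (ModuleCat.{u} R)ᵒᵖ ℕ :=
  (((linearYoneda R C).obj Y).rightOp.mapHomologicalComplex _).obj P.complex

/-- A class in the derived functor `Ext` is represented by a cocycle on a projective resolution. -/
def Represents {X Y : C} (P : ProjectiveResolution X) (n : ℕ)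
    (e : ((_root_.Ext R C n).obj (op X)).obj Y) (f : P.complex.X n ⟶ Y) : Prop :=
  ∃ e' : ((P.homComplex R Y).homology n).unop,
    (P.isoLeftDerivedObj ((linearYoneda R C).obj Y).rightOp n).hom.unop.hom e' = e ∧
    (P.homComplex R Y).UnopRepresents n e' f

variable {X Y : C} (P : ProjectiveResolution X) {n : ℕ}

lemma exists_represents (e : ((_root_.Ext R C n).obj (op X)).obj Y) :
    ∃ f, P.complex.d (n + 1) n ≫ f = 0 ∧ P.Represents n e f := by
  have hs : Function.Surjective
      (P.isoLeftDerivedObj ((linearYoneda R C).obj Y).rightOp n).hom.unop.hom :=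
    (ModuleCat.epi_iff_surjective _).1 inferInstance
  obtain ⟨e', rfl⟩ := hs e
  obtain ⟨f, hf, h⟩ := (P.homComplex R Y).unopRepresents_exists_cocycle n e'
  rw [ChainComplex.prev] at hf
  exact ⟨f, hf, e', rfl, h⟩

lemma exists_class_represents (f : P.complex.X n ⟶ Y) (hf : P.complex.d (n + 1) n ≫ f = 0) :
    ∃ e : ((_root_.Ext R C n).obj (op X)).obj Y, P.Represents n e f := by
  obtain ⟨e', h⟩ := (P.homComplex R Y).unopRepresents_exists_class n f
    (by rw [ChainComplex.prev]; exact hf)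
  exact ⟨_, e', rfl, h⟩

variable {P}

lemma Represents.eq_zero_iff [HasExt.{u} C] {e : ((_root_.Ext R C n).obj (op X)).obj Y}
    {f : P.complex.X n ⟶ Y} (h : P.Represents n e f) (hf : P.complex.d (n + 1) n ≫ f = 0) :
    e = 0 ↔ P.extMk f (n + 1) rfl hf = 0 := by
  obtain ⟨e', rfl, h⟩ := h
  have hi : Function.Injective
      (P.isoLeftDerivedObj ((linearYoneda R C).obj Y).rightOp n).hom.unop.hom :=
    (ModuleCat.mono_iff_injective _).1 inferInstance
  rw [extMk_eq_zero_iff_exists_next]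
  exact (map_eq_zero_iff _ hi).trans h.eq_zero_iff

lemma Represents.map {X' : C} {P' : ProjectiveResolution X'} {g : X' ⟶ X} (φ : Hom P' P g)
    {e : ((_root_.Ext R C n).obj (op X)).obj Y} {f : P.complex.X n ⟶ Y}
    (h : P.Represents n e f) :
    P'.Represents n ((((_root_.Ext R C n).map g.op).app Y).hom e) (φ.hom.f n ≫ f) := by
  obtain ⟨e', rfl, h⟩ := h
  refine ⟨_, ?_, h.map ((((linearYoneda R C).obj Y).rightOp.mapHomologicalComplex _).map φ.hom)⟩
  have := isoLeftDerivedObj_hom_naturality g P' P φ.hom (by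
    simpa using φ.hom_f_zero_comp_π_f_zero)
    ((linearYoneda R C).obj Y).rightOp n
  exact congr($(congrArg Quiver.Hom.unop this.symm).hom e')

end CategoryTheory.ProjectiveResolution

/-! ### Vanishing of local cohomology, expressed on Ext classes. -/

section LocalCohomology

open CategoryTheory.ProjectiveResolution

variable {R : Type u} [CommRing R]

/-- The projection from the quotient by a larger power of an ideal to the quotient by a
smaller power. -/
abbrev powFactor (a : Ideal R) {k l : ℕ} (h : k ≤ l) : (R ⧸ a ^ l) →ₗ[R] (R ⧸ a ^ k) :=
  Submodule.factor (Ideal.pow_le_pow_right h)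

/-- The vanishing of the local cohomology module of degree `i`: each class in
`Ext^i(R / a ^ k, N)` dies in `Ext^i(R / a ^ l, N)` for some larger `l`. -/
def LCVanish (a : Ideal R) (i : ℕ) (N : Type u) [AddCommGroup N] [Module R N] : Prop :=
  ∀ (k : ℕ) (e : Abelian.Ext (ModuleCat.of R (R ⧸ a ^ k)) (ModuleCat.of R N) i),
    ∃ (l : ℕ) (h : k ≤ l),
      (Abelian.Ext.mk₀ (ModuleCat.ofHom (powFactor a h))).comp e (zero_add i) = 0

variable (a : Ideal R) (i : ℕ) (N : Type u) [AddCommGroup N] [Module R N]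

/-- Evaluation at `N` commutes with the colimit of functors, and a filtered colimit of modules is
zero exactly when each element dies at a later stage. -/
lemma localCohomology_subsingleton_iff :
    Subsingleton ((localCohomology a i).obj (ModuleCat.of R N)) ↔
      ∀ (k : ℕ) (e : ((_root_.Ext R (ModuleCat.{u} R) i).obj
        (op (ModuleCat.of R (R ⧸ a ^ k)))).obj (ModuleCat.of R N)),
      ∃ (l : ℕ) (h : k ≤ l), (((_root_.Ext R (ModuleCat.{u} R) i).map
        (ModuleCat.ofHom (powFactor a h)).op).app (ModuleCat.of R N)).hom e = 0 := by
  let D := localCohomology.diagram (localCohomology.idealPowersDiagram a) i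
  let F := D ⋙ (evaluation (ModuleCat.{u} R) (ModuleCat.{u} R)).obj (ModuleCat.of R N)
  have : PreservesFilteredColimitsOfSize.{0, 0} (forget (ModuleCat.{u} R)) :=
    preservesSmallestFilteredColimits_of_preservesFilteredColimits _
  have e : (localCohomology a i).obj (ModuleCat.of R N) ≅ colimit F :=
    colimitObjIsoColimitCompEvaluation D (ModuleCat.of R N)
  have he : Subsingleton ((localCohomology a i).obj (ModuleCat.of R N)) ↔
      Subsingleton (colimit F : ModuleCat.{u} R) := e.toLinearEquiv.toEquiv.subsingleton_congr
  rw [he]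
  constructor
  · intro h k x
    obtain ⟨j, g, hg⟩ := Concrete.colimit_rep_eq_zero R F (op (op k)) x
      (Subsingleton.elim _ _)
    exact ⟨j.unop.unop, leOfHom g.unop.unop, hg⟩
  · intro h
    refine ⟨fun x y => ?_⟩
    suffices ∀ x : (colimit F : ModuleCat.{u} R), x = 0 by rw [this x, this y]
    intro x
    obtain ⟨j, y, rfl⟩ := Concrete.colimit_exists_rep F x
    obtain ⟨l, hl, hy⟩ := h j.unop.unop y
    have := congr($(colimit.w F (Quiver.Hom.op (Quiver.Hom.op (homOfLE hl)) :
      j ⟶ op (op l))).hom y)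
    rw [← this]
    exact (congrArg _ hy).trans (map_zero (colimit.ι F (op (op l))).hom)

/-- `localCohomology` uses the derived functor Ext, `LCVanish` uses `Abelian.Ext`. In both, a class
is zero iff its cocycle on a projective resolution is a coboundary, and both transition maps are
precomposition with the same lift; no isomorphism of the two Ext theories is needed. -/
theorem lcVanish_iff :
    LCVanish a i N ↔ Subsingleton ((localCohomology a i).obj (ModuleCat.of R N)) := by
  rw [localCohomology_subsingleton_iff]
  let key (k l : ℕ) (h : k ≤ l) :
      Hom (projectiveResolution (ModuleCat.of R (R ⧸ a ^ l)))
        (projectiveResolution (ModuleCat.of R (R ⧸ a ^ k)))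
        (ModuleCat.ofHom (powFactor a h)) :=
    { hom := ProjectiveResolution.lift (ModuleCat.ofHom (powFactor a h)) _ _
      hom_f_zero_comp_π_f_zero :=
        (ProjectiveResolution.lift_commutes_zero _ _ _).trans (by simp) }
  constructor
  · intro H k e
    obtain ⟨f, hf, hr⟩ := exists_represents (projectiveResolution _) e
    obtain ⟨l, h, hl⟩ := H k (extMk _ f _ rfl hf)
    refine ⟨l, h, ?_⟩
    rw [mk₀_comp_extMk f _ rfl hf (key k l h)] at hl
    exact ((hr.map (key k l h)).eq_zero_iff _).2 hl
  · intro H k e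
    obtain ⟨f, hf, rfl⟩ := extMk_surjective (projectiveResolution _) e _ rfl
    obtain ⟨e', hr⟩ := exists_class_represents (R := R) _ f hf
    obtain ⟨l, h, hl⟩ := H k e'
    refine ⟨l, h, ?_⟩
    rw [mk₀_comp_extMk f _ rfl hf (key k l h)]
    exact ((hr.map (key k l h)).eq_zero_iff _).1 hl

end LocalCohomology

end

/-! ### Long exact sequences of Ext for unbundled modules. -/

section

open CategoryTheory

namespace ModuleExt

variable {R : Type u} [CommRing R]

/-- The `Ext` modules of unbundled modules. -/
abbrev MExt (R : Type u) [CommRing R] (A B : Type u) [AddCommGroup A] [Module R A] [AddCommGroup B]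
    [Module R B] (i : ℕ) : Type u :=
  Abelian.Ext (ModuleCat.of R A) (ModuleCat.of R B) i

variable {A B C A' B' C' M N : Type u} [AddCommGroup A] [Module R A] [AddCommGroup B] [Module R B]
  [AddCommGroup C] [Module R C] [AddCommGroup A'] [Module R A'] [AddCommGroup B'] [Module R B']
  [AddCommGroup C'] [Module R C'] [AddCommGroup M] [Module R M] [AddCommGroup N] [Module R N]
  {i : ℕ}

/-- The class in `Ext^0` of a linear map. -/
noncomputable def mk (f : A →ₗ[R] B) : MExt R A B 0 := Abelian.Ext.mk₀ (ModuleCat.ofHom f)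

lemma mk_surjective (e : MExt R A B 0) : ∃ f : A →ₗ[R] B, mk f = e := by
  obtain ⟨f, rfl⟩ := (Abelian.Ext.mk₀_bijective (ModuleCat.of R A) (ModuleCat.of R B)).2 e
  exact ⟨f.hom, rfl⟩

lemma mk_eq_zero_iff (f : A →ₗ[R] B) : mk f = 0 ↔ f = 0 := by
  rw [mk, Abelian.Ext.mk₀_eq_zero_iff]
  exact ⟨fun h => congrArg ModuleCat.Hom.hom h, fun h => by rw [h]; rfl⟩

/-- The pullback of extension classes. -/
noncomputable def pull (f : A →ₗ[R] B) (i : ℕ) : MExt R B N i →ₗ[R] MExt R A N i where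
  toFun e := (Abelian.Ext.mk₀ (ModuleCat.ofHom f)).comp e (zero_add i)
  map_add' x y := by simp
  map_smul' r x := by simp

/-- The pushforward of extension classes. -/
noncomputable def push (f : A →ₗ[R] B) (i : ℕ) : MExt R N A i →ₗ[R] MExt R N B i where
  toFun e := e.comp (Abelian.Ext.mk₀ (ModuleCat.ofHom f)) (add_zero i)
  map_add' x y := by simp
  map_smul' r x := by simp

lemma pull_mk (f : A →ₗ[R] B) (g : B →ₗ[R] C) : pull f 0 (mk g) = mk (g ∘ₗ f) := by
  simp [pull, mk, ModuleCat.ofHom_comp]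

lemma push_mk (f : A →ₗ[R] B) (g : B →ₗ[R] C) : push g 0 (mk f) = mk (g ∘ₗ f) := by
  simp [push, mk, ModuleCat.ofHom_comp]

lemma pull_pull (f : A →ₗ[R] B) (g : B →ₗ[R] C) (e : MExt R C N i) :
    pull f i (pull g i e) = pull (g ∘ₗ f) i e := by
  simp [pull, ModuleCat.ofHom_comp]

lemma push_push (f : A →ₗ[R] B) (g : B →ₗ[R] C) (e : MExt R N A i) :
    push g i (push f i e) = push (g ∘ₗ f) i e := by
  simp only [push, ModuleCat.ofHom_comp, LinearMap.coe_mk, AddHom.coe_mk]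
  rw [Abelian.Ext.comp_assoc _ _ _ (add_zero i) (add_zero 0) (by omega),
    Abelian.Ext.mk₀_comp_mk₀]

lemma pull_push (f : A →ₗ[R] B) (g : M →ₗ[R] N) (e : MExt R B M i) :
    pull f i (push g i e) = push g i (pull f i e) := by
  simp only [pull, push, LinearMap.coe_mk, AddHom.coe_mk]
  rw [Abelian.Ext.comp_assoc _ _ _ (zero_add i) (add_zero i) (by omega)]

lemma pull_smul_id (r : R) (e : MExt R A N i) : pull (r • LinearMap.id) i e = r • e := by
  change (Abelian.Ext.mk₀ (r • 𝟙 (ModuleCat.of R A))).comp e (zero_add i) = _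
  rw [Abelian.Ext.mk₀_smul, Abelian.Ext.smul_comp, Abelian.Ext.mk₀_id_comp]

lemma push_smul_id (r : R) (e : MExt R N A i) : push (r • LinearMap.id) i e = r • e := by
  change e.comp (Abelian.Ext.mk₀ (r • 𝟙 (ModuleCat.of R A))) (add_zero i) = _
  rw [Abelian.Ext.mk₀_smul, Abelian.Ext.comp_smul, Abelian.Ext.comp_mk₀_id]

lemma pull_zero (e : MExt R B N i) : pull (0 : A →ₗ[R] B) i e = 0 := by
  have := pull_smul_id (0 : R) e
  rw [zero_smul, zero_smul] at this
  have h0 : (0 : A →ₗ[R] B) = ((0 : R) • LinearMap.id) ∘ₗ (0 : A →ₗ[R] B) := by simp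
  rw [h0, ← pull_pull, zero_smul, this, map_zero]

lemma push_zero (e : MExt R N A i) : push (0 : A →ₗ[R] B) i e = 0 := by
  have := push_smul_id (0 : R) e
  rw [zero_smul, zero_smul] at this
  have h0 : (0 : A →ₗ[R] B) = (0 : A →ₗ[R] B) ∘ₗ ((0 : R) • LinearMap.id) := by simp
  rw [h0, ← push_push, zero_smul, this, map_zero]

/-- A short exact sequence of modules. -/
structure IsSES (f : A →ₗ[R] B) (g : B →ₗ[R] C) : Prop where
  inj : Function.Injective f
  exact : Function.Exact f g
  surj : Function.Surjective g

lemma isSES_ker {g : B →ₗ[R] C} (hg : Function.Surjective g) :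
    IsSES (LinearMap.ker g).subtype g :=
  ⟨Subtype.val_injective, LinearMap.exact_subtype_ker_map g, hg⟩

lemma isSES_quotient (p : Submodule R B) : IsSES p.subtype p.mkQ :=
  ⟨Subtype.val_injective, LinearMap.exact_subtype_mkQ p, p.mkQ_surjective⟩

lemma isSES_of_injective {f : A →ₗ[R] B} (hf : Function.Injective f) :
    IsSES f (LinearMap.range f).mkQ :=
  ⟨hf, LinearMap.exact_map_mkQ_range f, Submodule.mkQ_surjective _⟩

namespace IsSES

variable {f : A →ₗ[R] B} {g : B →ₗ[R] C} (h : IsSES f g)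

include h in
lemma comp_eq_zero : g ∘ₗ f = 0 := h.exact.linearMap_comp_eq_zero

/-- The short complex attached to a short exact sequence. -/
abbrev complex : ShortComplex (ModuleCat.{u} R) :=
  ShortComplex.mk (ModuleCat.ofHom f) (ModuleCat.ofHom g)
    (by rw [← ModuleCat.ofHom_comp, h.comp_eq_zero]; rfl)

lemma shortExact : h.complex.ShortExact :=
  ModuleCat.shortComplex_shortExact _ h.exact h.inj h.surj

/-- The connecting map in the first variable. -/
noncomputable def δpull (i : ℕ) : MExt R A N i →ₗ[R] MExt R C N (i + 1) where
  toFun e := h.shortExact.extClass.comp e (add_comm 1 i)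
  map_add' x y := by simp
  map_smul' r x := by simp

/-- The connecting map in the second variable. -/
noncomputable def δpush (i : ℕ) : MExt R N C i →ₗ[R] MExt R N A (i + 1) where
  toFun e := e.comp h.shortExact.extClass rfl
  map_add' x y := by simp
  map_smul' r x := by simp

lemma exists_of_δpull_eq_zero {e : MExt R A N i} (he : h.δpull i e = 0) : ∃ e', pull f i e' = e :=
  Abelian.Ext.contravariant_sequence_exact₁ h.shortExact _ e (add_comm 1 i) he

include h in
lemma exists_of_pull_left_eq_zero {e : MExt R B N i} (he : pull f i e = 0) :
    ∃ e', pull g i e' = e :=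
  Abelian.Ext.contravariant_sequence_exact₂ h.shortExact _ e he

lemma exists_of_pull_right_eq_zero {e : MExt R C N (i + 1)} (he : pull g (i + 1) e = 0) :
    ∃ e', h.δpull i e' = e :=
  Abelian.Ext.contravariant_sequence_exact₃ h.shortExact _ e he (add_comm 1 i)

include h in
lemma eq_zero_of_pull_right_zero {e : MExt R C N 0} (he : pull g 0 e = 0) : e = 0 := by
  obtain ⟨φ, rfl⟩ := mk_surjective e
  rw [pull_mk, mk_eq_zero_iff] at he
  rw [mk_eq_zero_iff]
  ext x
  obtain ⟨y, rfl⟩ := h.surj x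
  exact congr($he y)

lemma exists_of_push_left_eq_zero {e : MExt R N A (i + 1)} (he : push f (i + 1) e = 0) :
    ∃ e', h.δpush i e' = e :=
  Abelian.Ext.covariant_sequence_exact₁ _ h.shortExact e he rfl

include h in
lemma exists_of_push_right_eq_zero {e : MExt R N B i} (he : push g i e = 0) :
    ∃ e', push f i e' = e :=
  Abelian.Ext.covariant_sequence_exact₂ _ h.shortExact e he

lemma exists_of_δpush_eq_zero {e : MExt R N C i} (he : h.δpush i e = 0) : ∃ e', push g i e' = e :=
  Abelian.Ext.covariant_sequence_exact₃ _ h.shortExact e rfl he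

include h in
lemma eq_zero_of_push_left_zero {e : MExt R N A 0} (he : push f 0 e = 0) : e = 0 := by
  obtain ⟨φ, rfl⟩ := mk_surjective e
  rw [push_mk, mk_eq_zero_iff] at he
  rw [mk_eq_zero_iff]
  ext x
  exact h.inj (by simpa using congr($he x))

lemma δpush_push (e : MExt R N B i) : h.δpush i (push g i e) = 0 := by
  change (e.comp (Abelian.Ext.mk₀ h.complex.g) (add_zero i)).comp h.shortExact.extClass rfl = 0
  rw [Abelian.Ext.comp_assoc _ _ _ (add_zero i) (zero_add 1) (by omega)]
  rw [h.shortExact.comp_extClass, Abelian.Ext.comp_zero]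

lemma push_δpull (φ : M →ₗ[R] N) (e : MExt R A M i) :
    push φ (i + 1) (h.δpull i e) = h.δpull i (push φ i e) :=
  Abelian.Ext.comp_assoc _ _ _ (add_comm 1 i) (add_zero i) (by omega)

lemma pull_δpush (φ : M →ₗ[R] N) (e : MExt R N C i) :
    pull φ (i + 1) (h.δpush i e) = h.δpush i (pull φ i e) :=
  (Abelian.Ext.comp_assoc _ _ _ (zero_add i) rfl (by omega)).symm

lemma pull_δpull {f' : A' →ₗ[R] B'} {g' : B' →ₗ[R] C'} (h' : IsSES f' g') (α : A →ₗ[R] A')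
    (β : B →ₗ[R] B') (γ : C →ₗ[R] C') (hα : f' ∘ₗ α = β ∘ₗ f) (hγ : g' ∘ₗ β = γ ∘ₗ g)
    (e : MExt R A' N i) : pull γ (i + 1) (h'.δpull i e) = h.δpull i (pull α i e) := by
  let F : h.complex ⟶ h'.complex :=
    { τ₁ := ModuleCat.ofHom α
      τ₂ := ModuleCat.ofHom β
      τ₃ := ModuleCat.ofHom γ
      comm₁₂ := by rw [← ModuleCat.ofHom_comp, hα]; rfl
      comm₂₃ := by rw [← ModuleCat.ofHom_comp, hγ]; rfl }
  have := ShortComplex.ShortExact.extClass_naturality h.shortExact h'.shortExact F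
  change (Abelian.Ext.mk₀ F.τ₃).comp (h'.shortExact.extClass.comp e (add_comm 1 i))
    (zero_add (i + 1)) =
    h.shortExact.extClass.comp ((Abelian.Ext.mk₀ F.τ₁).comp e (zero_add i)) (add_comm 1 i)
  rw [← Abelian.Ext.comp_assoc _ _ _ (zero_add 1) (add_comm 1 i) (by omega), ← this,
    Abelian.Ext.comp_assoc _ _ _ (add_zero 1) (zero_add i) (by omega)]

end IsSES

variable (R) in
/-- The vanishing of an `Ext` module. -/
def ExtZero (A B : Type u) [AddCommGroup A] [Module R A] [AddCommGroup B] [Module R B]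
    (i : ℕ) : Prop := ∀ e : MExt R A B i, e = 0

lemma extZero_of_subsingleton_left [Subsingleton A] : ExtZero R A N i := by
  intro e
  have := pull_smul_id (1 : R) e
  rwa [Subsingleton.elim ((1 : R) • LinearMap.id : A →ₗ[R] A) 0, pull_zero, one_smul, eq_comm]
    at this

lemma extZero_of_subsingleton_right [Subsingleton A] : ExtZero R N A i := by
  intro e
  have := push_smul_id (1 : R) e
  rwa [Subsingleton.elim ((1 : R) • LinearMap.id : A →ₗ[R] A) 0, push_zero, one_smul, eq_comm]
    at this

lemma extZero_of_projective [Module.Projective R A] : ExtZero R A N (i + 1) := fun e =>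
  have : Projective (ModuleCat.of R A) := (IsProjective.iff_projective A).1 inferInstance
  e.eq_zero_of_projective

namespace IsSES

variable {f : A →ₗ[R] B} {g : B →ₗ[R] C} (h : IsSES f g)
include h

lemma extZero_pull_middle (h₁ : ExtZero R A N i) (h₃ : ExtZero R C N i) : ExtZero R B N i := by
  intro e
  obtain ⟨e', rfl⟩ := h.exists_of_pull_left_eq_zero (h₁ (pull f i e))
  rw [h₃ e', map_zero]

lemma extZero_pull_right (h₁ : ExtZero R A N i) (h₂ : ExtZero R B N (i + 1)) :
    ExtZero R C N (i + 1) := by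
  intro e
  obtain ⟨e', rfl⟩ := h.exists_of_pull_right_eq_zero (h₂ (pull g (i + 1) e))
  rw [h₁ e', map_zero]

lemma extZero_pull_right_zero (h₂ : ExtZero R B N 0) : ExtZero R C N 0 :=
  fun _ => h.eq_zero_of_pull_right_zero (h₂ _)

lemma extZero_pull_left (h₂ : ExtZero R B N i) (h₃ : ExtZero R C N (i + 1)) : ExtZero R A N i := by
  intro e
  obtain ⟨e', rfl⟩ := h.exists_of_δpull_eq_zero (h₃ (h.δpull i e))
  rw [h₂ e', map_zero]

lemma extZero_push_right (h₁ : ExtZero R N A (i + 1)) (h₂ : ExtZero R N B i) :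
    ExtZero R N C i := by
  intro e
  obtain ⟨e', rfl⟩ := h.exists_of_δpush_eq_zero (h₁ (h.δpush i e))
  rw [h₂ e', map_zero]

lemma extZero_push_middle (h₁ : ExtZero R N A i) (h₃ : ExtZero R N C i) : ExtZero R N B i := by
  intro e
  obtain ⟨e', rfl⟩ := h.exists_of_push_right_eq_zero (h₃ (push g i e))
  rw [h₁ e', map_zero]

end IsSES

lemma exists_injective_embedding (R : Type u) [CommRing R] (M : Type u) [AddCommGroup M]
    [Module R M] : ∃ (I : Type u) (_ : AddCommGroup I) (_ : Module R I) (f : M →ₗ[R] I),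
      Function.Injective f ∧
      ∀ (N : Type u) [AddCommGroup N] [Module R N] (i : ℕ), ExtZero R N I (i + 1) := by
  let I := Injective.under (ModuleCat.of R M)
  have : Injective I := inferInstance
  exact ⟨I, inferInstance, inferInstance, (Injective.ι (ModuleCat.of R M)).hom,
    (ModuleCat.mono_iff_injective _).1 inferInstance, fun N _ _ i e => e.eq_zero_of_injective⟩

end ModuleExt

end

/-! ### Long exact sequence of local cohomology, in terms of vanishing. -/

section

open CategoryTheory

namespace ModuleExt

variable {R : Type u} [CommRing R]

section LongExact

variable {A B C : Type u} [AddCommGroup A] [Module R A] [AddCommGroup B] [Module R B]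
  [AddCommGroup C] [Module R C] {a : Ideal R} {i : ℕ}

lemma lcVanish_of_extZero (h : ∀ k, ExtZero R (R ⧸ a ^ k) A i) : LCVanish a i A :=
  fun k e => ⟨k, le_rfl, by rw [h k e, Abelian.Ext.comp_zero]⟩

lemma lcVanish_of_subsingleton [Subsingleton A] : LCVanish a i A :=
  lcVanish_of_extZero fun _ => extZero_of_subsingleton_right

lemma powFactor_comp {k l m : ℕ} (h : k ≤ l) (h' : l ≤ m) :
    powFactor a h ∘ₗ powFactor a h' = powFactor a (h.trans h') := by
  ext; rfl

variable {f : A →ₗ[R] B} {g : B →ₗ[R] C} (h : IsSES f g)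
include h

lemma IsSES.lcVanish_middle (h₁ : LCVanish a i A) (h₃ : LCVanish a i C) : LCVanish a i B := by
  intro k e
  obtain ⟨l, hl, he⟩ := h₃ k (push g i e)
  change pull (powFactor a hl) i _ = 0 at he
  rw [pull_push] at he
  obtain ⟨e', he'⟩ := h.exists_of_push_right_eq_zero he
  obtain ⟨m, hm, he₁⟩ := h₁ l e'
  change pull (powFactor a hm) i _ = 0 at he₁
  refine ⟨m, hl.trans hm, ?_⟩
  change pull (powFactor a _) i e = 0
  rw [← powFactor_comp hl hm, ← pull_pull, ← he', pull_push, he₁, map_zero]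

lemma IsSES.lcVanish_right (h₁ : LCVanish a (i + 1) A) (h₂ : LCVanish a i B) :
    LCVanish a i C := by
  intro k e
  obtain ⟨l, hl, he⟩ := h₁ k (h.δpush i e)
  change pull (powFactor a hl) (i + 1) _ = 0 at he
  rw [h.pull_δpush] at he
  obtain ⟨e', he'⟩ := h.exists_of_δpush_eq_zero he
  obtain ⟨m, hm, he₁⟩ := h₂ l e'
  change pull (powFactor a hm) i _ = 0 at he₁
  refine ⟨m, hl.trans hm, ?_⟩
  change pull (powFactor a _) i e = 0
  rw [← powFactor_comp hl hm, ← pull_pull, ← he', pull_push, he₁, map_zero]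

lemma IsSES.lcVanish_left (h₂ : LCVanish a (i + 1) B) (h₃ : LCVanish a i C) :
    LCVanish a (i + 1) A := by
  intro k e
  obtain ⟨l, hl, he⟩ := h₂ k (push f (i + 1) e)
  change pull (powFactor a hl) (i + 1) _ = 0 at he
  rw [pull_push] at he
  obtain ⟨e', he'⟩ := h.exists_of_push_left_eq_zero he
  obtain ⟨m, hm, he₁⟩ := h₃ l e'
  change pull (powFactor a hm) i _ = 0 at he₁
  refine ⟨m, hl.trans hm, ?_⟩
  change pull (powFactor a _) (i + 1) e = 0
  rw [← powFactor_comp hl hm, ← pull_pull, ← he', h.pull_δpush, he₁, map_zero]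

lemma IsSES.lcVanish_left_zero (h₂ : LCVanish a 0 B) : LCVanish a 0 A := by
  intro k e
  obtain ⟨l, hl, he⟩ := h₂ k (push f 0 e)
  change pull (powFactor a hl) 0 _ = 0 at he
  rw [pull_push] at he
  exact ⟨l, hl, h.eq_zero_of_push_left_zero he⟩

end LongExact

lemma lcVanish_congr {A B : Type u} [AddCommGroup A] [Module R A] [AddCommGroup B] [Module R B]
    {a : Ideal R} {i : ℕ} (e : A ≃ₗ[R] B) (h : LCVanish a i A) : LCVanish a i B :=
  IsSES.lcVanish_middle (g := (0 : B →ₗ[R] PUnit.{u + 1}))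
    (f := e.toLinearMap) ⟨e.injective, fun x => by simp, fun x => ⟨0, rfl⟩⟩ h
    lcVanish_of_subsingleton

/-- Each element is annihilated by a power of the ideal. -/
def IsPowTorsion (a : Ideal R) (T : Type u) [AddCommGroup T] [Module R T] : Prop :=
  ∀ t : T, ∃ n : ℕ, ∀ r ∈ a ^ n, r • t = 0

variable {a : Ideal R}

/-! ### Torsion modules are acyclic for local cohomology. -/

section Torsion

variable {T T' : Type u} [AddCommGroup T] [Module R T] [AddCommGroup T'] [Module R T']

lemma IsPowTorsion.of_injective (h : IsPowTorsion a T) {f : T' →ₗ[R] T}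
    (hf : Function.Injective f) : IsPowTorsion a T' := by
  intro t
  obtain ⟨n, hn⟩ := h (f t)
  exact ⟨n, fun r hr => hf (by rw [map_smul, hn r hr, map_zero])⟩

/-- A torsion module is its own H^0: an element `t` killed by `a ^ n` is the image of 1 under a map
from `R ⧸ a ^ n`, and this map dies on some `R ⧸ a ^ l` only if `t = 0`. -/
lemma IsPowTorsion.subsingleton (h : IsPowTorsion a T) (h₀ : LCVanish a 0 T) :
    Subsingleton T := by
  suffices ∀ t : T, t = 0 from ⟨fun x y => by rw [this x, this y]⟩
  intro t
  obtain ⟨n, hn⟩ := h t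
  let f : (R ⧸ a ^ n) →ₗ[R] T := Submodule.liftQ _ (LinearMap.toSpanSingleton R T t) hn
  obtain ⟨l, hl, he⟩ := h₀ n (mk f)
  change pull (powFactor a hl) 0 _ = 0 at he
  rw [pull_mk, mk_eq_zero_iff] at he
  have h1 : f (Submodule.Quotient.mk 1) = t := (Submodule.liftQ_apply _ _ _).trans (by simp)
  exact h1.symm.trans congr($he (Submodule.Quotient.mk 1))

variable [IsNoetherianRing R]

/-- The Artin-Rees lemma for a short exact sequence. -/
lemma IsSES.exists_artinRees {G P F : Type u} [AddCommGroup G] [Module R G] [AddCommGroup P]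
    [Module R P] [AddCommGroup F] [Module R F] [Module.Finite R P] {f : G →ₗ[R] P}
    {g : P →ₗ[R] F} (h : IsSES f g) (a : Ideal R) (l : ℕ) :
    ∃ (m : ℕ) (K Q : Type u) (_ : AddCommGroup K) (_ : Module R K) (_ : AddCommGroup Q)
      (_ : Module R Q) (f' : K →ₗ[R] Q) (g' : Q →ₗ[R] (a ^ m • ⊤ : Submodule R F))
      (α : K →ₗ[R] (a ^ l • ⊤ : Submodule R G)) (β : Q →ₗ[R] P), IsSES f' g' ∧
      f ∘ₗ ((a ^ l • ⊤ : Submodule R G).subtype ∘ₗ α) = β ∘ₗ f' ∧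
      g ∘ₗ β = (a ^ m • ⊤ : Submodule R F).subtype ∘ₗ g' := by
  obtain ⟨s, hs⟩ := Ideal.exists_pow_inf_eq_pow_smul a (LinearMap.ker g)
  have hs' : a ^ (l + s) • (⊤ : Submodule R P) ⊓ LinearMap.ker g ≤ a ^ l • LinearMap.ker g := by
    rw [hs (l + s) (by omega), Nat.add_sub_cancel]
    exact Submodule.smul_mono le_rfl inf_le_right
  let Q : Submodule R P := a ^ (l + s) • ⊤
  have hQ : Submodule.map g Q = a ^ (l + s) • (⊤ : Submodule R F) := by
    rw [Submodule.map_smul'', Submodule.map_top, LinearMap.range_eq_top.2 h.surj]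
  let g' : Q →ₗ[R] (a ^ (l + s) • (⊤ : Submodule R F) : Submodule R F) :=
    g.restrict fun x hx => hQ.le (Submodule.mem_map_of_mem hx)
  have hg' : Function.Surjective g' := by
    rintro ⟨y, hy⟩
    obtain ⟨x, hx, rfl⟩ := hQ.ge hy
    exact ⟨⟨x, hx⟩, rfl⟩
  have hlf : Submodule.map f (a ^ l • ⊤) = a ^ l • LinearMap.ker g := by
    rw [Submodule.map_smul'', Submodule.map_top, h.exact.linearMap_ker_eq]
  have hmem (x : LinearMap.ker g') : ∃ y : (a ^ l • ⊤ : Submodule R G), f y = (x : Q) := by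
    obtain ⟨y, hy, hyx⟩ := hlf.ge (hs' ⟨x.1.2, congrArg Subtype.val x.2⟩)
    exact ⟨⟨y, hy⟩, hyx⟩
  choose α hα using hmem
  refine ⟨l + s, LinearMap.ker g', Q, inferInstance, inferInstance, inferInstance, inferInstance,
    (LinearMap.ker g').subtype, g',
    { toFun := α
      map_add' := fun x y => Subtype.ext (h.inj (by simp [hα]))
      map_smul' := fun r x => Subtype.ext (h.inj (by simp [hα])) },
    Q.subtype, isSES_ker hg', ?_, rfl⟩
  ext x
  exact hα x

/-- By Artin–Rees, `a ^ m F` is the quotient in a short exact sequence whose kernel maps into `a ^ l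
G`; naturality of the connecting map then carries the vanishing up one degree. -/
lemma IsSES.exists_pull_δpull_eq_zero {G P F N : Type u} [AddCommGroup G] [Module R G]
    [AddCommGroup P] [Module R P] [AddCommGroup F] [Module R F] [AddCommGroup N] [Module R N]
    [Module.Finite R P] {f : G →ₗ[R] P} {g : P →ₗ[R] F} (h : IsSES f g) {j l : ℕ}
    (e : MExt R G N j) (he : pull (a ^ l • (⊤ : Submodule R G)).subtype j e = 0) :
    ∃ m : ℕ, pull (a ^ m • (⊤ : Submodule R F)).subtype (j + 1) (h.δpull j e) = 0 := by
  obtain ⟨m, K, Q, _, _, _, _, f', g', α, β, hS', hα, hβ⟩ := h.exists_artinRees a l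
  refine ⟨m, ?_⟩
  rw [hS'.pull_δpull h _ β _ hα hβ, ← pull_pull, he, map_zero, map_zero]

/-- A class in `Ext` from a finite module to a torsion module vanishes on `a ^ l F`. -/
lemma IsPowTorsion.exists_pull_eq_zero (h : IsPowTorsion a T) (j : ℕ) (F : Type u)
    [AddCommGroup F] [Module R F] [Module.Finite R F] (e : MExt R F T j) :
    ∃ l : ℕ, pull (a ^ l • (⊤ : Submodule R F)).subtype j e = 0 := by
  induction j generalizing F with
  | zero =>
    obtain ⟨f, rfl⟩ := mk_surjective e
    obtain ⟨s, hs⟩ := (Module.Finite.fg_top : (⊤ : Submodule R F).FG)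
    choose n hn using fun t : F => h (f t)
    refine ⟨s.sup n, ?_⟩
    rw [pull_mk, mk_eq_zero_iff]
    have key : a ^ (s.sup n) • (⊤ : Submodule R F) ≤ LinearMap.ker f := by
      rw [← hs, Submodule.smul_le]
      intro r hr x hx
      have : Submodule.span R (s : Set F) ≤ LinearMap.ker (r • f) := by
        rw [Submodule.span_le]
        intro y hy
        exact hn y r (Ideal.pow_le_pow_right (Finset.le_sup hy) hr)
      simpa using this hx
    ext x
    exact key x.2
  | succ j ih =>
    obtain ⟨n, g, hg⟩ := Module.Finite.exists_fin' R F
    have hS := isSES_ker hg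
    obtain ⟨e', rfl⟩ := hS.exists_of_pull_right_eq_zero
      (e := e) (extZero_of_projective (R := R) (A := Fin n → R) _)
    obtain ⟨l, hl⟩ := ih (LinearMap.ker g) e'
    exact hS.exists_pull_δpull_eq_zero e' hl

/-- A class of degree `i + 1` on `R ⧸ a ^ k` comes from a class of degree `i` on `a ^ k`, which
vanishes on some `a ^ l * a ^ k = a ^ (l + k)`; hence it dies on `R ⧸ a ^ (l + k)`. -/
lemma IsPowTorsion.lcVanish_succ (h : IsPowTorsion a T) (i : ℕ) : LCVanish a (i + 1) T := by
  intro k e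
  have hS := isSES_quotient (a ^ k)
  obtain ⟨e', rfl⟩ := hS.exists_of_pull_right_eq_zero
      (e := e) (extZero_of_projective (R := R) (A := R) _)
  obtain ⟨l, hl⟩ := h.exists_pull_eq_zero i _ e'
  refine ⟨l + k, by omega, ?_⟩
  change pull (powFactor a _) (i + 1) _ = 0
  have hle : a ^ (l + k) ≤ a ^ k := Ideal.pow_le_pow_right (by omega)
  rw [(isSES_quotient (a ^ (l + k))).pull_δpull hS (Submodule.inclusion hle) LinearMap.id _
    rfl rfl]
  have hα (x : (a ^ (l + k) : Ideal R)) : Submodule.inclusion hle x ∈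
      a ^ l • (⊤ : Submodule R (a ^ k : Ideal R)) := by
    have h₂ : Submodule.map (a ^ k).subtype (a ^ l • ⊤) = a ^ (l + k) := by
      rw [Submodule.map_smul'', Submodule.map_top, Submodule.range_subtype, pow_add, smul_eq_mul]
    obtain ⟨y, hy, hyx⟩ := h₂.ge x.2
    rwa [show Submodule.inclusion hle x = y from Subtype.ext hyx.symm]
  have : Submodule.inclusion hle = (a ^ l • (⊤ : Submodule R (a ^ k : Ideal R))).subtype ∘ₗ
    LinearMap.codRestrict _ (Submodule.inclusion hle) hα := rfl
  rw [this, ← pull_pull, hl, map_zero, map_zero]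

end Torsion

/-! ### Ext out of arbitrary, not necessarily finite, torsion modules. -/

section DirectSum

open DirectSum

variable {ι : Type u} [DecidableEq ι] {F : ι → Type u} [∀ t, AddCommGroup (F t)]
  [∀ t, Module R (F t)]

lemma extZero_directSum {M : Type u} [AddCommGroup M] [Module R M] {j : ℕ}
    (h : ∀ t, ExtZero R (F t) M j) : ExtZero R (⨁ t, F t) M j := by
  induction j generalizing M with
  | zero =>
    intro e
    obtain ⟨f, rfl⟩ := mk_surjective e
    rw [mk_eq_zero_iff]
    refine DirectSum.linearMap_ext R fun t => ?_
    have := h t (mk (f ∘ₗ DirectSum.lof R ι F t))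
    rwa [mk_eq_zero_iff] at this
  | succ j ih =>
    obtain ⟨I, _, _, f, hf, hI⟩ := exists_injective_embedding R M
    have hS := isSES_of_injective hf
    intro e
    obtain ⟨e', rfl⟩ := hS.exists_of_push_left_eq_zero (hI _ _ (push f (j + 1) e))
    rcases j with _ | j
    -- In degree 1 the maps from `F t` to the cokernel of `f` need not vanish, but each lifts to
    -- `I`, and the lifts assemble on the direct sum.
    · obtain ⟨φ, rfl⟩ := mk_surjective e'
      have (t : ι) : ∃ ψ : F t →ₗ[R] I,
          (LinearMap.range f).mkQ ∘ₗ ψ = φ ∘ₗ DirectSum.lof R ι F t := by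
        obtain ⟨e, he⟩ := hS.exists_of_δpush_eq_zero
          (h t (hS.δpush 0 (mk (φ ∘ₗ DirectSum.lof R ι F t))))
        obtain ⟨ψ, rfl⟩ := mk_surjective e
        refine ⟨ψ, ?_⟩
        rw [push_mk] at he
        exact Abelian.Ext.mk₀_bijective _ _ |>.1 he |> congrArg ModuleCat.Hom.hom
      choose ψ hψ using this
      have hφ : φ = (LinearMap.range f).mkQ ∘ₗ DirectSum.toModule R ι I ψ := by
        refine DirectSum.linearMap_ext R fun t => ?_
        rw [← hψ t]
        ext x
        simp
      rw [hφ, ← push_mk, hS.δpush_push]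
    · rw [ih (fun t => hS.extZero_push_right (h t) (hI _ _)) e', map_zero]

/-- A torsion module is a quotient of a torsion direct sum of quotients of the ring by powers
of the ideal. -/
lemma IsPowTorsion.exists_cover {T : Type u} [AddCommGroup T] [Module R T]
    (h : IsPowTorsion a T) : ∃ (k : T → ℕ) (p : (⨁ t : T, R ⧸ a ^ k t) →ₗ[R] T),
      Function.Surjective p ∧ IsPowTorsion a (⨁ t : T, R ⧸ a ^ k t) := by
  classical
  choose k hk using h
  let F : Type u := ⨁ t : T, R ⧸ a ^ k t
  let p : F →ₗ[R] T := DirectSum.toModule R T T fun t =>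
    Submodule.liftQ _ (LinearMap.toSpanSingleton R T t) (hk t)
  have hp : Function.Surjective p := fun t =>
    ⟨DirectSum.lof R T (fun t => R ⧸ a ^ k t) t (Submodule.Quotient.mk 1), by
      rw [DirectSum.toModule_lof]
      exact (Submodule.liftQ_apply _ _ _).trans (by simp)⟩
  have hF : IsPowTorsion a F := by
    intro x
    induction x using DirectSum.induction_on with
    | zero => exact ⟨0, by simp⟩
    | of t x =>
      refine ⟨k t, fun r hr => ?_⟩
      obtain ⟨y, rfl⟩ := Submodule.Quotient.mk_surjective _ x
      change r • DirectSum.lof R T (fun t => R ⧸ a ^ k t) t _ = 0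
      have h₀ : r • (Submodule.Quotient.mk y : R ⧸ a ^ k t) = 0 :=
        (Submodule.Quotient.mk_eq_zero _).2 (Ideal.mul_mem_right y _ hr)
      rw [← map_smul, h₀, map_zero]
    | add x y hx hy =>
      obtain ⟨m, hm⟩ := hx
      obtain ⟨m', hm'⟩ := hy
      refine ⟨max m m', fun r hr => ?_⟩
      rw [smul_add, hm r (Ideal.pow_le_pow_right (le_max_left _ _) hr),
        hm' r (Ideal.pow_le_pow_right (le_max_right _ _) hr), add_zero]
  exact ⟨k, p, hp, hF⟩

/-- If `Ext^j(R / a ^ k, M)` vanishes for `j < n`, then so does `Ext^j(T, M)` for every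
torsion module `T`. -/
lemma IsPowTorsion.extZero {M : Type u} [AddCommGroup M] [Module R M] {n : ℕ}
    (hM : ∀ k, ∀ j < n, ExtZero R (R ⧸ a ^ k) M j) {j : ℕ} (hj : j < n) {T : Type u}
    [AddCommGroup T] [Module R T] (h : IsPowTorsion a T) : ExtZero R T M j := by
  classical
  induction j generalizing T with
  | zero =>
    obtain ⟨k, p, hp, -⟩ := h.exists_cover
    exact (isSES_ker hp).extZero_pull_right_zero (extZero_directSum fun t => hM _ 0 hj)
  | succ j ih =>
    obtain ⟨k, p, hp, hF⟩ := h.exists_cover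
    -- The kernel of the cover is again torsion, so the induction hypothesis applies to it.
    exact (isSES_ker hp).extZero_pull_right
      (ih (by omega) (hF.of_injective (f := (LinearMap.ker p).subtype) Subtype.val_injective))
      (extZero_directSum fun t => hM _ _ hj)

end DirectSum

section Grade

variable [IsNoetherianRing R] {M : Type u} [AddCommGroup M] [Module R M] [Module.Finite R M]

/-- `Ext^j(R / a ^ k, M)` vanishes below the length of a regular sequence in `a`. -/
lemma extZero_of_isRegular (hM : a • (⊤ : Submodule R M) ≠ ⊤) (rs : List R)
    (hrs : ∀ r ∈ rs, r ∈ a) (hreg : RingTheory.Sequence.IsRegular M rs) (k : ℕ) {j : ℕ}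
    (hj : j < rs.length) : ExtZero R (R ⧸ a ^ k) M j := by
  have := ModuleCat.subsingleton_ext_of_exists_isRegular a (ModuleCat.of R (R ⧸ a ^ k)) (by
    change Module.support R (R ⧸ a ^ k) ⊆ _
    rw [Module.support_eq_zeroLocus, Ideal.annihilator_quotient,
      PrimeSpectrum.zeroLocus_subset_zeroLocus_iff]
    exact fun x hx => ⟨k, Ideal.pow_mem_pow hx k⟩) (ModuleCat.of R M) (lt_top_iff_ne_top.2 hM)
    rs hrs hreg j hj
  exact fun e => Subsingleton.elim _ _

end Grade

end ModuleExt

end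

/-! ### Localizations and a Čech complex built from iterated cones. -/

section

open CategoryTheory

namespace ModuleExt

variable {R : Type u} [CommRing R]

section Localization

variable (x : R) (M : Type u) [AddCommGroup M] [Module R M]

/-- The localization of a module away from an element. -/
abbrev Loc : Type u := LocalizedModule (Submonoid.powers x) M

/-- The canonical map to the localization. -/
noncomputable abbrev toLoc : M →ₗ[R] Loc x M := LocalizedModule.mkLinearMap _ M

variable {x M}

lemma Loc.smul_pow_bijective (n : ℕ) : Function.Bijective fun l : Loc x M => x ^ n • l := by
  exact (Module.End.isUnit_iff _).1 (IsLocalizedModule.map_units (S := Submonoid.powers x)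
    (toLoc x M) ⟨x ^ n, n, rfl⟩)

lemma Loc.exists_pow_smul_eq (l : Loc x M) : ∃ (m : M) (t : ℕ), x ^ t • l = toLoc x M m := by
  obtain ⟨⟨m, ⟨_, t, rfl⟩⟩, h⟩ := IsLocalizedModule.surj (Submonoid.powers x) (toLoc x M) l
  exact ⟨m, t, h⟩

lemma Loc.exists_pow_smul_eq_zero {m : M} (h : toLoc x M m = 0) : ∃ u : ℕ, x ^ u • m = 0 := by
  obtain ⟨⟨_, u, rfl⟩, h⟩ := (IsLocalizedModule.eq_zero_iff (Submonoid.powers x) _).1 h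
  exact ⟨u, h⟩

variable {N : Type u} [AddCommGroup N] [Module R N]

/-- The functoriality of the localization. -/
noncomputable def Loc.map (x : R) (f : M →ₗ[R] N) : Loc x M →ₗ[R] Loc x N :=
  IsLocalizedModule.map (Submonoid.powers x) (toLoc x M) (toLoc x N) f

@[simp]
lemma Loc.map_toLoc (f : M →ₗ[R] N) (m : M) : Loc.map x f (toLoc x M m) = toLoc x N (f m) :=
  IsLocalizedModule.map_apply _ _ _ _ _

lemma Loc.map_map {P : Type u} [AddCommGroup P] [Module R P] (f : M →ₗ[R] N) (g : N →ₗ[R] P)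
    (h : ∀ m, g (f m) = 0) (l : Loc x M) : Loc.map x g (Loc.map x f l) = 0 := by
  obtain ⟨m, t, hm⟩ := l.exists_pow_smul_eq
  refine (Loc.smul_pow_bijective t).1 ?_
  simp only [← map_smul, hm, map_toLoc, h, map_zero, smul_zero]

end Localization

section Invisible

variable (a : Ideal R) {C T : Type u} [AddCommGroup C] [Module R C] [AddCommGroup T] [Module R T]

/-- The action of `x ^ k` on Ext can be computed on either argument: it is invertible through `C`
and zero through `T`. -/
lemma extZero_of_pow_smul {x : R} {k : ℕ} (hC : Function.Bijective fun c : C => x ^ k • c)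
    (hT : ∀ t : T, x ^ k • t = 0) (j : ℕ) : ExtZero R C T j ∧ ExtZero R T C j := by
  let φ : C ≃ₗ[R] C := LinearEquiv.ofBijective (x ^ k • LinearMap.id) hC
  have h₁ : (x ^ k • LinearMap.id) ∘ₗ φ.symm.toLinearMap = LinearMap.id := by
    ext c
    exact φ.apply_symm_apply c
  have h₂ : φ.symm.toLinearMap ∘ₗ (x ^ k • LinearMap.id) = LinearMap.id := by
    ext c
    exact φ.symm_apply_apply c
  have h₃ : (x ^ k • LinearMap.id : T →ₗ[R] T) = 0 := by
    ext t
    exact hT t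
  constructor
  · intro e
    have := pull_smul_id (1 : R) e
    rw [one_smul, one_smul, ← h₁, ← pull_pull, pull_smul_id, ← push_smul_id, h₃, push_zero,
      map_zero] at this
    exact this.symm
  · intro e
    have := push_smul_id (1 : R) e
    rw [one_smul, one_smul, ← h₂, ← push_push, push_smul_id, ← pull_smul_id, h₃, pull_zero,
      map_zero] at this
    exact this.symm

variable (C) in
/-- A module with no extensions by, or of, modules killed by a power of the ideal. -/
structure IsInvisible : Prop where
  left : ∀ (T : Type u) [AddCommGroup T] [Module R T] (k : ℕ), (∀ r ∈ a ^ k, ∀ t : T, r • t = 0) →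
    ∀ j, ExtZero R C T j
  right : ∀ k j, ExtZero R (R ⧸ a ^ k) C j

variable {a}

lemma isInvisible_of_subsingleton [Subsingleton C] : IsInvisible a C :=
  ⟨fun _ _ _ _ _ _ => extZero_of_subsingleton_left, fun _ _ => extZero_of_subsingleton_right⟩

lemma IsInvisible.lcVanish (h : IsInvisible a C) (i : ℕ) : LCVanish a i C :=
  lcVanish_of_extZero fun _ => h.right _ _

lemma isInvisible_loc {x : R} (hx : x ∈ a) (M : Type u) [AddCommGroup M] [Module R M] :
    IsInvisible a (Loc x M) := by
  refine ⟨fun T _ _ k hT j => (extZero_of_pow_smul (Loc.smul_pow_bijective k)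
    (hT _ (Ideal.pow_mem_pow hx k)) j).1, fun k j => (extZero_of_pow_smul
    (Loc.smul_pow_bijective k) (fun t => ?_) j).2⟩
  obtain ⟨y, rfl⟩ := Submodule.Quotient.mk_surjective _ t
  exact (Submodule.Quotient.mk_eq_zero _).2 (Ideal.mul_mem_right y _ (Ideal.pow_mem_pow hx k))

lemma IsInvisible.prod (hC : IsInvisible a C) (hT : IsInvisible a T) : IsInvisible a (C × T) := by
  have hS : IsSES (LinearMap.inl R C T) (LinearMap.snd R C T) :=
    ⟨LinearMap.inl_injective, .inl_snd, LinearMap.snd_surjective⟩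
  exact ⟨fun N _ _ k hN j => hS.extZero_pull_middle (hC.left N k hN j) (hT.left N k hN j),
    fun k j => hS.extZero_push_middle (hC.right k j) (hT.right k j)⟩

end Invisible

variable (R) in
/-- A complex of modules in nonnegative degrees. -/
structure Cx where
  /-- The terms. -/
  X : ℕ → ModuleCat.{u} R
  /-- The differential. -/
  d : ∀ i, X i →ₗ[R] X (i + 1)
  d_d : ∀ i k, d (i + 1) (d i k) = 0

namespace Cx

variable (K : Cx.{u} R)

/-- The boundaries. -/
def bdry : ∀ i, Submodule R (K.X i)
  | 0 => ⊥
  | i + 1 => LinearMap.range (K.d i)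

/-- The cohomology is torsion with respect to an element. -/
def TorsionAt (y : R) : Prop :=
  ∀ i (z : K.X i), K.d i z = 0 → ∃ s : ℕ, y ^ s • z ∈ K.bdry i

/-- The terms of the shifted mapping cone of the localization map. -/
def locConeX (x : R) : ℕ → ModuleCat.{u} R
  | 0 => K.X 0
  | i + 1 => ModuleCat.of R (K.X (i + 1) × Loc x (K.X i))

/-- The differential of the shifted mapping cone of the localization map. -/
noncomputable def locConeD (x : R) : ∀ i, K.locConeX x i →ₗ[R] K.locConeX x (i + 1)
  | 0 => LinearMap.prod (K.d 0) (toLoc x (K.X 0))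
  | i + 1 => LinearMap.prod (K.d (i + 1) ∘ₗ LinearMap.fst R _ _)
      (toLoc x (K.X (i + 1)) ∘ₗ LinearMap.fst R _ _ - Loc.map x (K.d i) ∘ₗ LinearMap.snd R _ _)

lemma locConeD_locConeD_zero (x : R) (k : K.X 0) :
    (K.d 1 (K.d 0 k), toLoc x (K.X 1) (K.d 0 k) - Loc.map x (K.d 0) (toLoc x (K.X 0) k)) =
      ((0, 0) : K.X 2 × Loc x (K.X 1)) := by
  rw [K.d_d, Loc.map_toLoc, sub_self]

lemma locConeD_locConeD_succ (x : R) (i : ℕ) (k : K.X (i + 1)) (l : Loc x (K.X i)) :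
    (K.d (i + 2) (K.d (i + 1) k), toLoc x (K.X (i + 2)) (K.d (i + 1) k) -
      Loc.map x (K.d (i + 1)) (toLoc x (K.X (i + 1)) k - Loc.map x (K.d i) l)) =
      ((0, 0) : K.X (i + 3) × Loc x (K.X (i + 2))) := by
  rw [K.d_d, map_sub, Loc.map_toLoc, Loc.map_map _ _ (K.d_d i), sub_zero, sub_self]

/-- The shifted mapping cone of the localization map of a complex. -/
noncomputable def locCone (x : R) : Cx.{u} R where
  X := K.locConeX x
  d := K.locConeD x
  d_d i k := match i with
    | 0 => K.locConeD_locConeD_zero x k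
    | i + 1 => K.locConeD_locConeD_succ x i k.1 k.2

variable {x : R}

/-- A pair as an element of the mapping cone. -/
def pair {i : ℕ} (k : K.X (i + 1)) (l : Loc x (K.X i)) : (K.locCone x).X (i + 1) := (k, l)

lemma exists_pair {i : ℕ} (z : (K.locCone x).X (i + 1)) : ∃ k l, z = K.pair (x := x) k l :=
  ⟨z.1, z.2, rfl⟩

lemma pair_add {i : ℕ} (k k' : K.X (i + 1)) (l l' : Loc x (K.X i)) :
    K.pair k l + K.pair k' l' = K.pair (k + k') (l + l') := rfl

lemma smul_pair {i : ℕ} (r : R) (k : K.X (i + 1)) (l : Loc x (K.X i)) :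
    r • K.pair k l = K.pair (r • k) (r • l) := rfl

lemma pair_eq_zero_iff {i : ℕ} (k : K.X (i + 1)) (l : Loc x (K.X i)) :
    K.pair k l = 0 ↔ k = 0 ∧ l = 0 := Prod.ext_iff

lemma d_pair {i : ℕ} (k : K.X (i + 1)) (l : Loc x (K.X i)) :
    (K.locCone x).d (i + 1) (K.pair k l) =
      K.pair (K.d (i + 1) k) (toLoc x _ k - Loc.map x (K.d i) l) := rfl

lemma pair_mem_bdry {i : ℕ} (m : K.X i) :
    K.pair (K.d i m) (toLoc x _ m) ∈ (K.locCone x).bdry (i + 1) := by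
  rcases i with _ | i
  · exact ⟨m, rfl⟩
  · refine ⟨K.pair m 0, ?_⟩
    rw [d_pair, map_zero, sub_zero]

/-- For a cocycle (k, l) write `x ^ t • l` = m/1. Since k/1 = dl, some power `x ^ u` kills dm − `x ^
t • k`, so `x ^ (u + t)` (k, l) is `x ^ u` times the boundary (dm, m/1). -/
lemma torsionAt_locCone_self (x : R) : (K.locCone x).TorsionAt x := by
  intro i z hz
  rcases i with _ | i
  · exact Loc.exists_pow_smul_eq_zero (M := K.X 0) (m := z) (congrArg Prod.snd hz)
  · obtain ⟨k, l, rfl⟩ := K.exists_pair z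
    rw [d_pair, pair_eq_zero_iff, sub_eq_zero] at hz
    obtain ⟨m, t, hm⟩ := l.exists_pow_smul_eq
    have h₁ : toLoc x _ (K.d i m - x ^ t • k) = 0 := by
      rw [map_sub, ← Loc.map_toLoc, ← hm, map_smul, map_smul, hz.2, sub_self]
    obtain ⟨u, hu⟩ := Loc.exists_pow_smul_eq_zero h₁
    rw [smul_sub, sub_eq_zero, smul_smul, ← pow_add] at hu
    refine ⟨u + t, ?_⟩
    rw [smul_pair, ← hu, pow_add, mul_smul, hm, ← map_smul, ← map_smul]
    exact K.pair_mem_bdry _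

/-- If `y ^ s • k` = dm, subtracting the boundary (dm, m/1) from `y ^ s` (k, l) leaves (0, l') with
l' a cocycle of the localized complex. Clearing denominators turns l' into a cocycle of `K`, where a
power of `y` makes it a boundary. -/
lemma TorsionAt.locCone {y : R} (h : K.TorsionAt y) (x : R) : (K.locCone x).TorsionAt y := by
  intro i z hz
  rcases i with _ | i
  · exact h 0 z (congrArg Prod.fst hz)
  · obtain ⟨k, l, rfl⟩ := K.exists_pair z
    rw [d_pair, pair_eq_zero_iff, sub_eq_zero] at hz
    obtain ⟨s, m, hm⟩ := h (i + 1) k hz.1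
    obtain ⟨l', hl'⟩ : ∃ l', l' = y ^ s • l - toLoc x _ m := ⟨_, rfl⟩
    have hdl' : Loc.map x (K.d i) l' = 0 := by
      rw [hl', map_sub, map_smul, ← hz.2, Loc.map_toLoc, hm, map_smul, sub_self]
    obtain ⟨n, t, hn⟩ := l'.exists_pow_smul_eq
    have hdn : toLoc x _ (K.d i n) = 0 := by
      rw [← Loc.map_toLoc, ← hn, map_smul, hdl', smul_zero]
    obtain ⟨u, hu⟩ := Loc.exists_pow_smul_eq_zero hdn
    obtain ⟨s', hs'⟩ := h i (x ^ u • n) (by rw [map_smul, hu])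
    have key : K.pair 0 (y ^ s' • l') ∈ (K.locCone x).bdry (i + 1) := by
      have e₁ : x ^ (u + t) • (y ^ s' • l') = toLoc x _ (y ^ s' • x ^ u • n) := by
        rw [map_smul, map_smul, ← hn, pow_add]
        simp only [smul_smul]
        congr 1
        ring
      -- Boundaries in degree 0 are zero, so there the element itself vanishes; in higher degrees
      -- the denominator must also be removed from the primitive.
      rcases i with _ | i
      · have e₂ : y ^ s' • x ^ u • n = 0 := hs'
        rw [e₂, map_zero] at e₁
        have e₃ : y ^ s' • l' = 0 :=
          (Loc.smul_pow_bijective (u + t)).1 (e₁.trans (smul_zero _).symm)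
        rw [e₃]
        exact zero_mem _
      · obtain ⟨q, hq⟩ := hs'
        obtain ⟨q', hq'⟩ := (Loc.smul_pow_bijective (u + t)).2 (toLoc x _ q)
        have e₃ : y ^ s' • l' = Loc.map x (K.d i) q' := by
          refine (Loc.smul_pow_bijective (u + t)).1 (e₁.trans ?_)
          rw [← hq, ← Loc.map_toLoc, ← hq']
          exact map_smul _ _ _
        refine ⟨K.pair 0 (-q'), ?_⟩
        rw [d_pair, map_zero, map_zero, map_neg, zero_sub, neg_neg, e₃]
    refine ⟨s' + s, ?_⟩
    have e : y ^ (s' + s) • K.pair k l =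
        y ^ s' • K.pair (K.d i m) (toLoc x _ m) + K.pair 0 (y ^ s' • l') := by
      rw [smul_pair, smul_pair, pair_add, add_zero, hm, hl', pow_add, mul_smul, mul_smul, smul_sub,
        add_sub_cancel]
    rw [e]
    exact add_mem (Submodule.smul_mem _ _ (K.pair_mem_bdry m)) key

/-- The complex concentrated in degree zero. -/
noncomputable def single (M : Type u) [AddCommGroup M] [Module R M] : Cx.{u} R where
  X i := match i with
    | 0 => ModuleCat.of R M
    | _ + 1 => ModuleCat.of R PUnit.{u + 1}
  d _ := 0
  d_d _ _ := rfl

/-- Each cone leaves degree 0 alone, adds a localization at an element of `a` to every positive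
degree, and lengthens the complex by one. -/
lemma exists_cech (a : Ideal R) (M : Type u) [AddCommGroup M] [Module R M] (l : List R)
    (hl : ∀ y ∈ l, y ∈ a) : ∃ (K : Cx.{u} R) (_ : K.X 0 ≃ₗ[R] M),
      (∀ i, IsInvisible a (K.X (i + 1))) ∧ (∀ i, l.length < i → Subsingleton (K.X i)) ∧
      ∀ y ∈ l, K.TorsionAt y := by
  induction l with
  | nil =>
    refine ⟨single M, LinearEquiv.refl R M, fun i => ?_, fun i hi => ?_, by simp⟩
    · exact isInvisible_of_subsingleton (C := PUnit)
    · obtain ⟨i, rfl⟩ := Nat.exists_eq_succ_of_ne_zero (by simp at hi; omega : i ≠ 0)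
      exact (inferInstance : Subsingleton PUnit)
  | cons x l ih =>
    obtain ⟨K, e, h₁, h₂, h₃⟩ := ih fun y hy => hl y (List.mem_cons_of_mem _ hy)
    refine ⟨K.locCone x, e, fun i => ?_, fun i hi => ?_, fun y hy => ?_⟩
    · exact (h₁ i).prod (isInvisible_loc (hl x List.mem_cons_self) (K.X i))
    · obtain ⟨i, rfl⟩ := Nat.exists_eq_succ_of_ne_zero (by omega : i ≠ 0)
      simp only [List.length_cons] at hi
      have := h₂ (i + 1) (by omega)
      have := h₂ i (by omega)
      have : Subsingleton (Loc x (K.X i)) := by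
        refine ⟨fun p q => ?_⟩
        have (p : Loc x (K.X i)) : p = 0 := by
          obtain ⟨m, t, hm⟩ := p.exists_pow_smul_eq
          refine (Loc.smul_pow_bijective t).1 (hm.trans ?_)
          rw [Subsingleton.elim m 0, map_zero]
          exact (smul_zero _).symm
        rw [this p, this q]
      exact (inferInstance : Subsingleton (K.X (i + 1) × Loc x (K.X i)))
    · rcases List.mem_cons.1 hy with rfl | hy
      · exact K.torsionAt_locCone_self y
      · exact (h₃ y hy).locCone K x

end Cx

end ModuleExt

end

/-! ### Dimension shifting along the Čech complex and the vanishing of Hom. -/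

section

open CategoryTheory

namespace ModuleExt

variable {R : Type u} [CommRing R]

/-- A Čech-type complex of a module, cut into short exact sequences: the terms `X i`, the cocycles
`Z i`, the coboundaries `B i` in degree `i + 1` and the cohomology `H i` in degree `i + 1`. -/
structure Cech (a : Ideal R) (M : Type u) [AddCommGroup M] [Module R M] (r : ℕ) where
  /-- The terms. -/
  X : ℕ → ModuleCat.{u} R
  /-- The cocycles. -/
  Z : ℕ → ModuleCat.{u} R
  /-- The coboundaries. -/
  B : ℕ → ModuleCat.{u} R
  /-- The cohomology in positive degrees. -/
  H : ℕ → ModuleCat.{u} R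
  /-- The inclusion of the cocycles. -/
  j : ∀ i, Z i →ₗ[R] X i
  /-- The projection to the coboundaries. -/
  p : ∀ i, X i →ₗ[R] B i
  /-- The inclusion of the coboundaries in the cocycles. -/
  f : ∀ i, B i →ₗ[R] Z (i + 1)
  /-- The projection to the cohomology. -/
  g : ∀ i, Z (i + 1) →ₗ[R] H i
  isSES_cocycles : ∀ i, IsSES (j i) (p i)
  isSES_cohomology : ∀ i, IsSES (f i) (g i)
  /-- The term in degree zero. -/
  e : X 0 ≃ₗ[R] M
  invisible : ∀ i, IsInvisible a (X (i + 1))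
  torsion_zero : IsPowTorsion a (Z 0)
  torsion : ∀ i, IsPowTorsion a (H i)
  bounded : ∀ i, r < i → Subsingleton (X i)

/-- The radical of the ideal of all `r` with `r • m ∈ N` contains every `y` in `l`, and the span is
finitely generated. -/
lemma exists_pow_smul_mem_of_span {M : Type u} [AddCommGroup M] [Module R M] (N : Submodule R M)
    (m : M) (l : List R) (h : ∀ y ∈ l, ∃ s : ℕ, y ^ s • m ∈ N) :
    ∃ n, ∀ r ∈ Ideal.span {y | y ∈ l} ^ n, r • m ∈ N := by
  let J : Ideal R := N.comap (LinearMap.toSpanSingleton R M m)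
  have hJ : Ideal.span {y | y ∈ l} ≤ J.radical := Ideal.span_le.2 fun y hy => h y hy
  obtain ⟨n, hn⟩ := Ideal.exists_pow_le_of_le_radical_of_fg hJ
    ((Submodule.fg_def).2 ⟨_, l.finite_toSet, rfl⟩)
  exact ⟨n, fun r hr => hn hr⟩

lemma Cech.exists (l : List R) (M : Type u) [AddCommGroup M] [Module R M] :
    Nonempty (Cech (Ideal.span {y | y ∈ l}) M l.length) := by
  obtain ⟨K, e, h₁, h₂, h₃⟩ := Cx.exists_cech (Ideal.span {y | y ∈ l}) M l
    fun y hy => Ideal.subset_span hy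
  have ht (i : ℕ) (z : K.X i) (hz : K.d i z = 0) :=
    exists_pow_smul_mem_of_span (K.bdry i) z l fun y hy => h₃ y hy i z hz
  let f (i : ℕ) : (K.X i ⧸ LinearMap.ker (K.d i)) →ₗ[R] LinearMap.ker (K.d (i + 1)) :=
    LinearMap.codRestrict _ (Submodule.liftQ _ (K.d i) le_rfl) (by
      intro x
      obtain ⟨y, rfl⟩ := Submodule.Quotient.mk_surjective _ x
      exact K.d_d i y)
  have hf (i : ℕ) : Function.Injective (f i) := by
    rw [← LinearMap.ker_eq_bot, LinearMap.ker_codRestrict, Submodule.ker_liftQ_eq_bot _ _ _ le_rfl]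
  exact ⟨{
    X := K.X
    Z := fun i => ModuleCat.of R (LinearMap.ker (K.d i))
    B := fun i => ModuleCat.of R (K.X i ⧸ LinearMap.ker (K.d i))
    H := fun i => ModuleCat.of R (LinearMap.ker (K.d (i + 1)) ⧸ LinearMap.range (f i))
    j := fun i => (LinearMap.ker (K.d i)).subtype
    p := fun i => (LinearMap.ker (K.d i)).mkQ
    f := f
    g := fun i => (LinearMap.range (f i)).mkQ
    isSES_cocycles := fun i => isSES_quotient _
    isSES_cohomology := fun i => isSES_of_injective (hf i)
    e := e
    invisible := h₁
    torsion_zero := by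
      rintro ⟨z, hz⟩
      obtain ⟨n, hn⟩ := ht 0 z hz
      exact ⟨n, fun r hr => Subtype.ext (hn r hr)⟩
    torsion := by
      intro i z
      obtain ⟨⟨z, hz⟩, rfl⟩ := Submodule.Quotient.mk_surjective _ z
      obtain ⟨n, hn⟩ := ht (i + 1) z hz
      refine ⟨n, fun r hr => (Submodule.Quotient.mk_eq_zero _).2 ?_⟩
      obtain ⟨y, hy⟩ := hn r hr
      exact ⟨Submodule.Quotient.mk y, Subtype.ext hy⟩
    bounded := h₂ }⟩

namespace Cech

variable {a : Ideal R} {M : Type u} [AddCommGroup M] [Module R M] {r : ℕ} (D : Cech a M r)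

lemma subsingleton_B {i : ℕ} (hi : r ≤ i) : Subsingleton (D.B i) := by
  have := D.bounded (i + 1) (by omega)
  exact ((D.isSES_cocycles (i + 1)).inj.comp (D.isSES_cohomology i).inj).subsingleton

lemma subsingleton_Z_zero (h : LCVanish a 0 M) : Subsingleton (D.Z 0) :=
  D.torsion_zero.subsingleton
    ((D.isSES_cocycles 0).lcVanish_left_zero (lcVanish_congr D.e.symm h))

variable [IsNoetherianRing R]

/-- Torsion modules contribute nothing in positive degrees and invisible ones nothing at all, so
H^{i+1} of `B j` shifts to H^{i+2} of `Z j`, then of `B (j - 1)`, and finally to H^{i+1+j} of `M`.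
-/
lemma lcVanish_of_B {i j : ℕ} (h : LCVanish a (i + 1) (D.B j)) : LCVanish a (i + 1 + j) M := by
  induction j generalizing i with
  | zero =>
    exact lcVanish_congr D.e
      ((D.isSES_cocycles 0).lcVanish_middle (D.torsion_zero.lcVanish_succ i) h)
  | succ j ih =>
    rw [show i + 1 + (j + 1) = i + 1 + 1 + j by ring]
    exact ih ((D.isSES_cohomology j).lcVanish_left
      ((D.isSES_cocycles (j + 1)).lcVanish_left ((D.invisible j).lcVanish _) h)
      ((D.torsion j).lcVanish_succ i))

lemma lcVanish_B {i j : ℕ} (h : LCVanish a (i + 1 + j) M) : LCVanish a (i + 1) (D.B j) := by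
  induction j generalizing i with
  | zero =>
    exact (D.isSES_cocycles 0).lcVanish_right (D.torsion_zero.lcVanish_succ _)
      (lcVanish_congr D.e.symm h)
  | succ j ih =>
    rw [show i + 1 + (j + 1) = i + 1 + 1 + j by ring] at h
    exact (D.isSES_cocycles (j + 1)).lcVanish_right
      ((D.isSES_cohomology j).lcVanish_middle (ih h) ((D.torsion j).lcVanish_succ _))
      ((D.invisible j).lcVanish _)

include D in
lemma lcVanish_of_lt {i : ℕ} (hi : r < i) : LCVanish a i M := by
  obtain ⟨i, rfl⟩ : ∃ i', i = i' + 1 + r := ⟨i - 1 - r, by omega⟩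
  have := D.subsingleton_B le_rfl
  exact D.lcVanish_of_B lcVanish_of_subsingleton

/-- The Čech cohomology is torsion, hence its own H^0, which is trapped between H^0 of `Z (j + 1)`
(zero, inside an invisible term) and H^1 of `B j`, which vanishes with H^{j+1} of `M`. -/
lemma subsingleton_H {j : ℕ} (h : LCVanish a (j + 1) M) : Subsingleton (D.H j) :=
  (D.torsion j).subsingleton ((D.isSES_cohomology j).lcVanish_right
    (D.lcVanish_B (by rwa [zero_add, add_comm]))
    ((D.isSES_cocycles (j + 1)).lcVanish_left_zero ((D.invisible j).lcVanish 0)))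

variable {n : ℕ} (hM : ∀ i, n ≤ i → LCVanish a i M) {T : Type u} [AddCommGroup T] [Module R T]
  {k : ℕ} (hT : ∀ r ∈ a ^ k, ∀ t : T, r • t = 0)

-- From degree `n` on the complex is exact, so vanishing descends from `B r = 0` through the
-- invisible terms.
include hM hT in
lemma extZero_B {i : ℕ} (hi : n ≤ i + 1) (j : ℕ) : ExtZero R (D.B i) T j := by
  obtain ⟨m, hm⟩ : ∃ m, m = r - i := ⟨_, rfl⟩
  induction m generalizing i j with
  | zero =>
    have := D.subsingleton_B (show r ≤ i by omega)
    exact extZero_of_subsingleton_left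
  | succ m ih =>
    have h₁ : ExtZero R (D.Z (i + 1)) T j := (D.isSES_cocycles (i + 1)).extZero_pull_left
      ((D.invisible i).left T k hT j) (ih (by omega) (j + 1) (by omega))
    have := D.subsingleton_H (hM _ hi)
    exact (D.isSES_cohomology i).extZero_pull_left h₁ extZero_of_subsingleton_left

variable {N : Type u} [AddCommGroup N] [Module R N]
  (hN : ∀ k, ∀ j < n, ExtZero R (R ⧸ a ^ k) N j) (π : N →ₗ[R] T)

-- While `i + 1 < n`, the obstruction in Ext^{i+1}(`H i`, `N`) to extending `e` to `Z (i + 1)` is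
-- zero. The extension has a coboundary on `B (i + 1)` that dies in `T` by induction, so its image
-- in `T` extends to the invisible `X (i + 1)` and is zero. Passing to `T` is essential: invisible
-- modules may have Ext into `N`.
include hM hT hN in
lemma push_eq_zero (i : ℕ) (e : MExt R (D.B i) N i) : push π i e = 0 := by
  obtain ⟨m, hm⟩ : ∃ m, m = n - (i + 1) := ⟨_, rfl⟩
  induction m generalizing i with
  | zero => exact D.extZero_B hM hT (by omega) i _
  | succ m ih =>
    have h₁ : (D.isSES_cohomology i).δpull i e = 0 :=
      (D.torsion i).extZero hN (by omega) _
    obtain ⟨e', rfl⟩ := (D.isSES_cohomology i).exists_of_δpull_eq_zero h₁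
    have h₂ : push π (i + 1) ((D.isSES_cocycles (i + 1)).δpull i e') = 0 := ih _ _ (by omega)
    rw [IsSES.push_δpull] at h₂
    obtain ⟨e'', he''⟩ := (D.isSES_cocycles (i + 1)).exists_of_δpull_eq_zero h₂
    rw [← pull_push, ← he'', (D.invisible i).left T k hT i e'', map_zero, map_zero]

include D hM hT hN in
/-- If the local cohomology of `M` vanishes in degrees at least `n` and `Ext^j(R / a ^ k, N)`
vanishes for `j < n`, then each composite `M → N → T`, where `T` is annihilated by a power of `a`,
is zero. -/
lemma comp_eq_zero (φ : M →ₗ[R] N) : π ∘ₗ φ = 0 := by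
  have h₀ : pull (D.j 0) 0 (ModuleExt.mk (φ ∘ₗ D.e.toLinearMap)) = 0 := by
    -- For `n = 0` there is no Ext hypothesis on `N`, but the torsion part of `M` is zero.
    rcases n with _ | n
    · have := D.subsingleton_Z_zero (hM 0 le_rfl)
      exact extZero_of_subsingleton_left _
    · exact D.torsion_zero.extZero hN (Nat.succ_pos n) _
  obtain ⟨e, he⟩ := (D.isSES_cocycles 0).exists_of_pull_left_eq_zero h₀
  have h₁ : push π 0 (ModuleExt.mk (φ ∘ₗ D.e.toLinearMap)) = 0 := by
    rw [← he, ← pull_push, D.push_eq_zero hM hT hN π 0 e, map_zero]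
  rw [push_mk, mk_eq_zero_iff] at h₁
  ext m
  simpa using congr($h₁ (D.e.symm m))

end Cech

variable [IsNoetherianRing R]

/-- The local cohomology modules vanish in large degrees. -/
lemma exists_lcVanish_of_lt (a : Ideal R) : ∃ r : ℕ, ∀ (M : Type u) [AddCommGroup M] [Module R M],
    ∀ i, r < i → LCVanish a i M := by
  obtain ⟨s, rfl⟩ := (isNoetherianRing_iff_ideal_fg R).1 ‹_› a
  refine ⟨s.toList.length, fun M _ _ i hi => ?_⟩
  obtain ⟨D⟩ := Cech.exists s.toList M
  have : Ideal.span {y | y ∈ s.toList} = Submodule.span R (s : Set R) := by simp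
  rw [this] at D
  exact D.lcVanish_of_lt hi

/-- Each `φ m` dies in every `N ⧸ a ^ k N`, so it is zero by Krull's intersection theorem. -/
lemma linearMap_eq_zero_of_lcVanish {a : Ideal R} (ha : a ≤ Ideal.jacobson ⊥) {M N : Type u}
    [AddCommGroup M] [Module R M] [AddCommGroup N] [Module R N] [Module.Finite R N] {n : ℕ}
    (hM : ∀ i, n ≤ i → LCVanish a i M) (hN : ∀ k, ∀ j < n, ExtZero R (R ⧸ a ^ k) N j)
    (φ : M →ₗ[R] N) : φ = 0 := by
  obtain ⟨s, hs⟩ := (isNoetherianRing_iff_ideal_fg R).1 ‹_› a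
  obtain ⟨D⟩ := Cech.exists s.toList M
  have : Ideal.span {y | y ∈ s.toList} = a := by rw [← hs]; simp
  rw [this] at D
  ext m
  have : φ m ∈ (⨅ k : ℕ, a ^ k • ⊤ : Submodule R N) := by
    rw [Submodule.mem_iInf]
    intro k
    have hT : ∀ r ∈ a ^ k, ∀ t : N ⧸ (a ^ k • ⊤ : Submodule R N), r • t = 0 := by
      intro r hr t
      obtain ⟨t, rfl⟩ := Submodule.Quotient.mk_surjective _ t
      exact (Submodule.Quotient.mk_eq_zero _).2 (Submodule.smul_mem_smul hr trivial)
    exact (Submodule.Quotient.mk_eq_zero _).1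
      congr($(D.comp_eq_zero hM hT hN (Submodule.mkQ _) φ) m)
  rwa [Ideal.iInf_pow_smul_eq_bot_of_le_jacobson _ ha] at this

end ModuleExt

end

/-! ### Local cohomological vanishing, supports and associated primes. -/

open scoped TensorProduct in
/-- A point of the support of a finite module `N` carries a nonzero map from `N` to the
corresponding quotient domain. -/
lemma Module.exists_linearMap_ne_zero_of_mem_support {R : Type u} [CommRing R]
    {N : Type u} [AddCommGroup N] [Module R N] [Module.Finite R N] {q : PrimeSpectrum R}
    (hq : q ∈ Module.support R N) : ∃ f : N →ₗ[R] R ⧸ q.asIdeal, f ≠ 0 := by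
  classical
  rw [Module.mem_support_iff_nontrivial_residueField_tensorProduct] at hq
  let K := q.asIdeal.ResidueField
  obtain ⟨v, hv⟩ := exists_ne (0 : K ⊗[R] N)
  have hv' := mt (Module.forall_dual_apply_eq_zero_iff K v).1 hv
  push Not at hv'
  obtain ⟨φ, hφ⟩ := hv'
  let g : N →ₗ[R] K := φ.restrictScalars R ∘ₗ TensorProduct.mk R K N 1
  have hg : g ≠ 0 := by
    intro h
    refine hφ ?_
    induction v using TensorProduct.induction_on with
    | zero => simp
    | add x y hx hy =>
      have hz : ∀ x : K ⊗[R] N, φ x = 0 := fun x => by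
        induction x using TensorProduct.induction_on with
        | zero => simp
        | add x y hx hy => simp [hx, hy]
        | tmul k n =>
          have h0 : φ (1 ⊗ₜ n) = 0 := LinearMap.congr_fun h n
          rw [← mul_one k, ← smul_eq_mul, ← TensorProduct.smul_tmul', map_smul, h0, smul_zero]
      exact hz _
    | tmul k n =>
      have h0 : φ (1 ⊗ₜ n) = 0 := LinearMap.congr_fun h n
      rw [← mul_one k, ← smul_eq_mul, ← TensorProduct.smul_tmul', map_smul, h0, smul_zero]
  obtain ⟨s, hs⟩ := (Module.Finite.fg_top : (⊤ : Submodule R N).FG)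
  -- A common denominator of the images of the generators; multiplying by its lift `c` moves `g`
  -- into `R ⧸ q`.
  obtain ⟨b, hb⟩ := IsLocalization.exist_integer_multiples_of_finset
    (nonZeroDivisors (R ⧸ q.asIdeal)) (s.image g)
  obtain ⟨c, hc⟩ := Ideal.Quotient.mk_surjective (b : R ⧸ q.asIdeal)
  let ι : (R ⧸ q.asIdeal) →ₗ[R] K := (Algebra.linearMap (R ⧸ q.asIdeal) K).restrictScalars R
  have hι : Function.Injective ι := IsFractionRing.injective (R ⧸ q.asIdeal) K
  have hbK (y : K) : c • y = (b : R ⧸ q.asIdeal) • y := by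
    rw [← hc, ← Ideal.Quotient.algebraMap_eq, algebraMap_smul]
  have hr : ∀ n, (c • g) n ∈ LinearMap.range ι := by
    have hle : (⊤ : Submodule R N) ≤ (LinearMap.range ι).comap (c • g) := by
      rw [← hs, Submodule.span_le]
      intro n hn
      obtain ⟨z, hz⟩ := hb (g n) (Finset.mem_image_of_mem _ hn)
      exact ⟨z, by rw [LinearMap.smul_apply, hbK]; exact hz⟩
    exact fun n => hle trivial
  refine ⟨(LinearEquiv.ofInjective ι hι).symm ∘ₗ (c • g).codRestrict _ hr, fun h => hg ?_⟩
  ext n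
  have h1 := LinearMap.congr_fun h n
  have h2 : (c • g).codRestrict _ hr n = 0 := by
    simpa using h1
  have h3 : c • g n = 0 := congrArg Subtype.val h2
  rw [hbK, Algebra.smul_def] at h3
  refine (mul_eq_zero.1 h3).resolve_left fun h0 => nonZeroDivisors.coe_ne_zero b (hι ?_)
  exact h0.trans (map_zero ι).symm

lemma Module.mem_support_ring_quotient_iff {R : Type u} [CommRing R] {I : Ideal R}
    {q : PrimeSpectrum R} : q ∈ Module.support R (R ⧸ I) ↔ I ≤ q.asIdeal := by
  rw [Module.support_of_algebra, Ideal.Quotient.algebraMap_eq, Ideal.mk_ker,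
    PrimeSpectrum.mem_zeroLocus, SetLike.coe_subset_coe]

/-- The support of a proper quotient of a domain `R ⧸ q` does not contain `q`. -/
lemma PrimeSpectrum.lt_of_mem_support_quotient {R : Type u} [CommRing R]
    {q p : PrimeSpectrum R} {B : Submodule R (R ⧸ q.asIdeal)}
    (hB : B ≠ ⊥) (hp : p ∈ Module.support R ((R ⧸ q.asIdeal) ⧸ B)) : q < p := by
  obtain ⟨y, hyB, hy⟩ := (Submodule.ne_bot_iff _).1 hB
  obtain ⟨x, rfl⟩ := Ideal.Quotient.mk_surjective y
  have hann : x ∈ Module.annihilator R ((R ⧸ q.asIdeal) ⧸ B) := by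
    rw [Module.mem_annihilator]
    intro z
    obtain ⟨z, rfl⟩ := Submodule.Quotient.mk_surjective _ z
    obtain ⟨z, rfl⟩ := Ideal.Quotient.mk_surjective z
    rw [← Submodule.Quotient.mk_smul, Submodule.Quotient.mk_eq_zero]
    have : x • Ideal.Quotient.mk q.asIdeal z = z • Ideal.Quotient.mk q.asIdeal x := by
      rw [Algebra.smul_def, Algebra.smul_def, mul_comm]; rfl
    rw [this]
    exact B.smul_mem _ hyB
  have hxp : x ∈ p.asIdeal := Module.annihilator_le_of_mem_support hp hann
  have hxq : x ∉ q.asIdeal := fun h => hy (Ideal.Quotient.eq_zero_iff_mem.2 h)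
  have hle : q.asIdeal ≤ p.asIdeal := by
    refine le_trans (fun r hr => ?_) (Module.annihilator_le_of_mem_support hp)
    rw [Module.mem_annihilator]
    intro z
    obtain ⟨z, rfl⟩ := Submodule.Quotient.mk_surjective _ z
    rw [← Submodule.Quotient.mk_smul, Algebra.smul_def, Ideal.Quotient.algebraMap_eq,
      Ideal.Quotient.eq_zero_iff_mem.2 hr, zero_mul, Submodule.Quotient.mk_zero]
  exact lt_of_le_not_ge hle fun h => hxq (h hxp)

namespace ModuleExt

variable {R : Type u} [CommRing R] [IsNoetherianRing R] {a : Ideal R}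

/-- Induction along a prime filtration; the support of an extension is the union of the supports of
its ends. -/
lemma lcVanish_of_forall_mem_support {i : ℕ} {N : Type u} [AddCommGroup N] [Module R N]
    [Module.Finite R N]
    (h : ∀ p : PrimeSpectrum R, p ∈ Module.support R N → LCVanish a i (R ⧸ p.asIdeal)) :
    LCVanish a i N := by
  revert h
  induction ‹Module.Finite R N› using
    IsNoetherianRing.induction_on_isQuotientEquivQuotientPrime R with
  | subsingleton N => exact fun _ => lcVanish_of_subsingleton
  | quotient N p f =>
    intro h
    refine lcVanish_congr f.symm (h p ?_)
    rw [f.support_eq, Module.mem_support_ring_quotient_iff]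
  | exact N₁ N₂ N₃ f g hf hg hfg h₁ h₃ =>
    intro h
    rw [Module.support_of_exact hfg hf hg] at h
    exact IsSES.lcVanish_middle ⟨hf, hfg, hg⟩ (h₁ fun p hp => h p (.inl hp))
      (h₃ fun p hp => h p (.inr hp))

/-- Vanishing of local cohomology in high degrees passes from a finite module `M` to the quotient
domains supported in the support of `M`. -/
lemma lcVanish_of_mem_support {M : Type u} [AddCommGroup M] [Module R M] [Module.Finite R M]
    {c : ℕ} (hM : ∀ i, c ≤ i → LCVanish a i M) {q : PrimeSpectrum R}
    (hq : q ∈ Module.support R M) {i : ℕ} (hi : c ≤ i) : LCVanish a i (R ⧸ q.asIdeal) := by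
  obtain ⟨r, hr⟩ := exists_lcVanish_of_lt a
  -- Descending induction on the degree, starting above the uniform bound `r`, with Noetherian
  -- induction on `q` inside each degree.
  suffices H : ∀ m i, r < i + m → c ≤ i → ∀ q ∈ Module.support R M,
      LCVanish a i (R ⧸ q.asIdeal) from H (r + 1) i (by omega) hi q hq
  intro m
  induction m with
  | zero => exact fun i hri _ q _ => hr _ _ hri
  | succ m ih =>
    intro i hri hi q
    induction q using
      (InvImage.wf PrimeSpectrum.asIdeal (wellFounded_gt (α := Ideal R))).induction with
    | _ q ihq =>
    intro hq
    obtain ⟨f, hf⟩ := Module.exists_linearMap_ne_zero_of_mem_support hq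
    -- The kernel is supported in Supp `M`, so degree `i + 1` is already known; this gives degree
    -- `i` for the image of `f`. The cokernel is supported on primes strictly above `q`, which the
    -- inner induction covers.
    have hker : LCVanish a (i + 1) (LinearMap.ker f) :=
      lcVanish_of_forall_mem_support fun p hp => ih (i + 1) (by omega) (by omega) p
        (Module.support_subset_of_injective _ (LinearMap.ker f).injective_subtype hp)
    have hrange : LCVanish a i (LinearMap.range f) :=
      IsSES.lcVanish_right (f := (LinearMap.ker f).subtype) (g := f.rangeRestrict)
        ⟨Submodule.injective_subtype _, fun x => by
          rw [← LinearMap.mem_ker, LinearMap.ker_rangeRestrict]; simp,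
          f.surjective_rangeRestrict⟩ hker (hM i hi)
    refine IsSES.lcVanish_middle (isSES_quotient (LinearMap.range f)) hrange
      (lcVanish_of_forall_mem_support fun p hp => ?_)
    have hlt := PrimeSpectrum.lt_of_mem_support_quotient (mt LinearMap.range_eq_bot.1 hf) hp
    exact ihq p hlt (Module.mem_support_mono hlt.le hq)

/-- Vanishing of local cohomology in high degrees can be tested on the associated primes. -/
lemma lcVanish_of_associatedPrimes {M : Type u} [AddCommGroup M] [Module R M] [Module.Finite R M]
    {c : ℕ} (hM : ∀ p ∈ associatedPrimes R M, ∀ i, c ≤ i → LCVanish a i (R ⧸ p)) {i : ℕ}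
    (hi : c ≤ i) : LCVanish a i M := by
  refine lcVanish_of_forall_mem_support fun q hq => ?_
  obtain ⟨p, hp, hpq⟩ := Ideal.exists_minimalPrimes_le (Module.annihilator_le_of_mem_support hq)
  have hass := Module.associatedPrimes.minimalPrimes_annihilator_subset_associatedPrimes R M hp
  exact lcVanish_of_mem_support (hM p hass) (Module.mem_support_ring_quotient_iff.2 hpq) hi

end ModuleExt

/-! ### Inequalities between grade and cohomological dimension. -/

section

open ModuleExt

variable {R : Type u} [CommRing R] (a : Ideal R)

section
variable {a} {N : Type u} [AddCommGroup N] [Module R N]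

lemma le_cohomologicalDim_of_not_lcVanish {i : ℕ} (h : ¬ LCVanish a i N) :
    ((i : ℕ∞) : WithBot ℕ∞) ≤ cohomologicalDim a N := by
  rw [lcVanish_iff, not_subsingleton_iff_nontrivial] at h
  exact le_iSup₂_of_le i h le_rfl

lemma cohomologicalDim_le {b : WithBot ℕ∞}
    (h : ∀ i : ℕ, ¬ LCVanish a i N → ((i : ℕ∞) : WithBot ℕ∞) ≤ b) : cohomologicalDim a N ≤ b := by
  refine iSup₂_le fun i hi => h i ?_
  rwa [lcVanish_iff, not_subsingleton_iff_nontrivial]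

lemma le_cohomologicalDim_of_exists {n : ℕ} (h : ¬ ∀ i, n ≤ i → LCVanish a i N) :
    ((n : ℕ∞) : WithBot ℕ∞) ≤ cohomologicalDim a N := by
  push Not at h
  obtain ⟨i, hi, hv⟩ := h
  refine le_trans ?_ (le_cohomologicalDim_of_not_lcVanish hv)
  exact WithBot.coe_le_coe.2 (Nat.cast_le.2 hi)

lemma moduleGrade_le_of_forall_length_le (hN : a • (⊤ : Submodule R N) ≠ ⊤) [Nontrivial N]
    {b : WithBot ℕ∞} (h : ∀ rs : List R, (∀ r ∈ rs, r ∈ a) →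
      RingTheory.Sequence.IsRegular N rs → ((rs.length : ℕ∞) : WithBot ℕ∞) ≤ b) :
    (moduleGrade a N : WithBot ℕ∞) ≤ b := by
  -- The empty regular sequence rules out `b = ⊥`.
  have h0 := h [] (by simp) (RingTheory.Sequence.IsRegular.nil R N)
  induction b with
  | bot => simp at h0
  | coe b =>
    rw [moduleGrade, if_neg hN, WithBot.coe_le_coe]
    exact iSup₂_le fun rs hrs => WithBot.coe_le_coe.1 (h rs hrs.1 hrs.2)

lemma smul_top_ne_top_of_le_jacobson [Module.Finite R N] [Nontrivial N]
    (ha : a ≤ Ideal.jacobson ⊥) :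
    a • (⊤ : Submodule R N) ≠ ⊤ := fun h =>
  top_ne_bot (Submodule.eq_bot_of_le_smul_of_le_jacobson_bot a ⊤ Module.Finite.fg_top h.ge ha)

variable [IsNoetherianRing R] {M : Type u} [AddCommGroup M] [Module R M] [Module.Finite R M]

/-- If the local cohomology of `R ⧸ p` vanished from the length of a regular sequence on, the
embedding of `R ⧸ p` in `M` would be the zero map. -/
lemma moduleGrade_le_cohomologicalDim_of_mem_associatedPrimes [Nontrivial M]
    (ha : a ≤ Ideal.jacobson ⊥) {p : Ideal R} (hp : p ∈ associatedPrimes R M) :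
    (moduleGrade a M : WithBot ℕ∞) ≤ cohomologicalDim a (R ⧸ p) := by
  have hne := smul_top_ne_top_of_le_jacobson (N := M) ha
  have : p.IsPrime := hp.isPrime
  refine moduleGrade_le_of_forall_length_le hne fun rs hrs hreg =>
    le_cohomologicalDim_of_exists fun hv => ?_
  obtain ⟨-, φ, hφ⟩ := (isAssociatedPrime_iff_exists_injective_linearMap p M).1 hp
  have h0 := linearMap_eq_zero_of_lcVanish ha hv
    (fun k j hj => extZero_of_isRegular hne rs hrs hreg k hj) φ
  exact one_ne_zero (hφ (by rw [h0]; rfl : φ (1 : R ⧸ p) = φ 0))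

lemma cohomologicalDim_quotient_le {p : Ideal R} (hp : p ∈ associatedPrimes R M) :
    cohomologicalDim a (R ⧸ p) ≤ cohomologicalDim a M := by
  refine cohomologicalDim_le fun i hi => le_cohomologicalDim_of_exists fun hv => hi ?_
  have : p.IsPrime := hp.isPrime
  refine lcVanish_of_mem_support (q := ⟨p, this⟩) hv ?_ le_rfl
  obtain ⟨-, φ, hφ⟩ := (isAssociatedPrime_iff_exists_injective_linearMap p M).1 hp
  exact Module.support_subset_of_injective φ hφ (Module.mem_support_ring_quotient_iff.2 le_rfl)

lemma cohomologicalDim_le_of_associatedPrimes {b : WithBot ℕ∞}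
    (h : ∀ p ∈ associatedPrimes R M, cohomologicalDim a (R ⧸ p) ≤ b) :
    cohomologicalDim a M ≤ b := by
  refine cohomologicalDim_le fun i hi => ?_
  by_contra hb
  refine hi (lcVanish_of_associatedPrimes (fun p hp => ?_) le_rfl)
  by_contra hv
  exact hb ((le_cohomologicalDim_of_exists hv).trans (h p hp))

end

end

theorem proposition2 {R : Type u} [CommRing R] [IsNoetherianRing R] (a : Ideal R)
    (ha : a ≤ Ideal.jacobson (⊥ : Ideal R))
    (M : Type u) [AddCommGroup M] [Module R M] [Module.Finite R M] [Nontrivial M] :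
    IsRelativeCohenMacaulay a M ↔
      ∀ p ∈ associatedPrimes R M,
        cohomologicalDim a (R ⧸ p) = (moduleGrade a M : WithBot ℕ∞) := by
  have hne := smul_top_ne_top_of_le_jacobson (N := M) ha
  constructor
  · rintro (h | ⟨-, h⟩) p hp
    · exact absurd h hne
    · exact le_antisymm (h ▸ cohomologicalDim_quotient_le hp)
        (moduleGrade_le_cohomologicalDim_of_mem_associatedPrimes ha hp)
  · intro h
    obtain ⟨p, hp⟩ := associatedPrimes.nonempty R M
    exact .inr ⟨hne, le_antisymm (h p hp ▸ cohomologicalDim_quotient_le hp)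
      (cohomologicalDim_le_of_associatedPrimes fun p hp => (h p hp).le)⟩
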